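/- **Setting.** A seller offers one of $K\ge 1$ prices $0\le p_1<\dots<p_K\le 1$ in each of $T\ge 1$ time steps. If price $p_{i_t}$ is offered at time $t$, the demand $D_t(p_{i_t})\in[0,1]$ is observed; the vectors $(D_t(p_k))_{k\le K}$ are independent over $t$, and for each $k$ the law of $D_t(p_k)$ does not depend on $t$. Put $\lambda_k=p_k\,\mathbb E[D_t(p_k)]$. With a price protection period of length $M\in\{0,1,2,\dots\}$, the expected regret is $$\mathrm{Regret}=T\max_{k}\lambda_k-\mathbb E\Big[\sum_{t=1}^T\min\{p_{i_s}: t\le s\le \min(t+M,T)\}\,D_t(p_{i_t})\Big].$$ $N_k(t)$ is the number of times price $k$ is offered before time $t$, and $\hat\lambda_k(t)$ is the average of its observed rewards $p_kD_s(p_k)$ at those times. **Phased template.** Phase $b=1,\dots,B$ occupies times $t_{b-1}+1,\dots,t_b$, where $t_0=0$, $t_B=T$. Initially all prices are plausible ($P_1=\{1,\dots,K\}$). In phase $b$ the prices in $P_b$ are offered in ascending order, in consecutive blocks of equal length (up to a rounding by at most one step); at the end of phase $b$ a test determines $P_{b+1}$. A confidence test with radius $r_i$ is $$P_{b+1}=\{i\in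 P_b:\ \hat\lambda_i(t_b+1)+r_i\ \ge\ \max_{j\in P_b}(\hat\lambda_j(t_b+1)-r_j)\},$$ with $r_i=\infty$ if $N_i(t_b+1)=0$. **LEAP++** is the template with the following sub-algorithms. 1. If $M\le\sqrt{KT}$ (improved UCB of Auer and Ortner): let $n_0=0$ and $n_b=\lceil 2^{2b+1}\log(2^{-2b}T)\rceil$ for $b\ge1$; $B=\max\{0,\lfloor\frac12\log_2(T/e)\rfloor\}+1$; $t_b=\min\{t_{b-1}+(n_b-n_{b-1})|P_b|,\,T\}$ for $b<B$ and $t_B=T$ (so unless the horizon is reached, each surviving price has been offered $n_b$ times by the end of phase $b<B$); $r_i=\sqrt{\log(2^{-2b}T)/(2N_i(t_b+1))}$. 2. If $\sqrt{KT}<M<K^{1/3}T^{2/3}$ (batched elimination of Gao et al.): $t_b=\min\{\lceil(\sqrt{eT})^{\,2-2^{1-b}}\rceil,\,T\}$ for $b<B$ and $t_B=T$, $B=\max\{1,\lceil\log_2\log(eT)\rceil\}$; $r_i=\sqrt{3\log(KT)/N_i(t_b+1)}$. 3. Otherwise (explore-then-commit): $B=2$, $t_1=\min\{K\lceil K^{-2/3}T^{2/3}\rceil,T\}$,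 $t_2=T$, and $P_2$ consists of a single maximizer of $\hat\lambda_i(t_1+1)$, ties being broken by any fixed rule. **Theorem.** There are universal constants $C>0$ and $n\in\mathbb N$ such that for all $K\ge1$, $T\ge1$, $M\ge0$, all price sets and all demand distributions as above, the expected regret of LEAP++ satisfies $$\mathrm{Regret}\le C\,(1+\log(KT))^n\Big(\sqrt{KT}+\min\{M,\,K^{1/3}T^{2/3}\}\Big),$$ that is, it is $\tilde O\big(\sqrt{KT}+\min\{M,K^{1/3}T^{2/3}\}\big)$. -/

import Mathlib

open MeasureTheory ProbabilityTheory

/-! ### The pricing model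

There are `K` prices `p 0 < p 1 < … < p (K - 1)`.  The `T` time steps are numbered `0, …, T - 1`.
A demand table `d : ℕ → Fin K → ℝ` holds the demand `d t k` that is realized at time `t` if price
`k` is offered, and a pricing sequence `i : ℕ → Fin K` holds the price offered at each time. -/

/-- Number of times that price `k` is offered before time `t`. -/
def pullCount {K : ℕ} (i : ℕ → Fin K) (t : ℕ) (k : Fin K) : ℕ :=
  ((Finset.range t).filter (fun s => i s = k)).card

/-- Empirical mean reward of price `k`, from the demands observed before time `t`. -/
noncomputable def empMean {K : ℕ} (p : Fin K → ℝ) (d : ℕ → Fin K → ℝ) (i : ℕ → Fin K)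
    (t : ℕ) (k : Fin K) : ℝ :=
  (∑ s ∈ (Finset.range t).filter (fun s => i s = k), p (i s) * d s (i s)) / pullCount i t k

/-- The final payment per unit of a customer arriving at time `t < T`: the smallest price among
times `t, …, t + M` that do not exceed the last time `T - 1`. -/
noncomputable def finalPrice {K : ℕ} (p : Fin K → ℝ) (T M : ℕ) (i : ℕ → Fin K) (t : ℕ) : ℝ :=
  (Finset.Icc t (t + M)).inf' (Finset.nonempty_Icc.2 (Nat.le_add_right t M))
    (fun s => p (i (min s (T - 1))))

/-- Total revenue over the horizon, net of all refunds. -/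
noncomputable def revenue {K : ℕ} (p : Fin K → ℝ) (T M : ℕ) (i : ℕ → Fin K)
    (d : ℕ → Fin K → ℝ) : ℝ :=
  ∑ t ∈ Finset.range T, finalPrice p T M i t * d t (i t)

/-! ### The phased exploration template -/

/-- A sub-algorithm of the phased template. Phases are numbered `1, …, numPhases`.
`phaseEnd b s m` is the intended end of phase `b` if it starts at time `s` with `m` plausible
prices.  `test b P N lam` is the set of prices that stay plausible after phase `b`, if `P` is the
set of prices plausible in phase `b`, and `N` and `lam` are the numbers of pulls and the
empirical mean rewards at the end of phase `b`. -/
structure PhasedAlgorithm (K : ℕ) where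
  numPhases : ℕ
  phaseEnd : ℕ → ℕ → ℕ → ℕ
  test : ℕ → Finset (Fin K) → (Fin K → ℕ) → (Fin K → ℝ) → Finset (Fin K)

/-- The state after `b` phases: the number `time` of elapsed steps, the prices that are
plausible in the next phase, and the prices offered so far (`choice s` for `s < time`). -/
structure PhaseState (K : ℕ) where
  time : ℕ
  plausible : Finset (Fin K)
  choice : ℕ → Fin K

/-- The price offered at the `j`-th step (`j = 0, …, ℓ - 1`) of a phase of length `ℓ` with set `P`
of plausible prices: `P` is run through once in ascending order, in consecutive blocks of
length `ℓ / |P|`, rounded so that block lengths differ by at most one. -/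
def slot {K : ℕ} [NeZero K] (P : Finset (Fin K)) (ℓ j : ℕ) : Fin K :=
  (P.sort (· ≤ ·)).getD (j * P.card / ℓ) 0

/-- The run of the template on a demand table: the state after `b` phases. Phases are cut at the
horizon `T`, and the last phase ends at `T`. The prices offered during a phase depend only on
demands that were observed in earlier phases. -/
noncomputable def PhasedAlgorithm.run {K : ℕ} [NeZero K] (A : PhasedAlgorithm K) (T : ℕ)
    (p : Fin K → ℝ) (d : ℕ → Fin K → ℝ) : ℕ → PhaseState K
  | 0 => ⟨0, Finset.univ, fun _ => 0⟩
  | b + 1 =>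
    let S := A.run T p d b
    let e : ℕ := if b + 1 = A.numPhases then T
      else min (A.phaseEnd (b + 1) S.time S.plausible.card) T
    let c : ℕ → Fin K := fun s =>
      if s < S.time then S.choice s else slot S.plausible (e - S.time) (s - S.time)
    ⟨e, A.test (b + 1) S.plausible (pullCount c e) (empMean p d c e), c⟩

/-- The sequence of prices offered by a phased algorithm. -/
noncomputable def PhasedAlgorithm.prices {K : ℕ} [NeZero K] (A : PhasedAlgorithm K) (T : ℕ)
    (p : Fin K → ℝ) (d : ℕ → Fin K → ℝ) : ℕ → Fin K :=
  (A.run T p d A.numPhases).choice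

/-- Confidence-bound elimination: keep the prices of `P` whose upper confidence bound
`lam i + √(ρ / N i)` is at least the lower confidence bound `lam j - √(ρ / N j)` of every `j ∈ P`.
The confidence radius of a price that was never offered is infinite. -/
noncomputable def confidenceTest {K : ℕ} (ρ : ℝ) (P : Finset (Fin K)) (N : Fin K → ℕ)
    (lam : Fin K → ℝ) : Finset (Fin K) :=
  open Classical in
  P.filter (fun i => ∀ j ∈ P, N i = 0 ∨ N j = 0 ∨
    lam j - √(ρ / N j) ≤ lam i + √(ρ / N i))

/-! ### The three sub-algorithms -/

/-- Number of times that each surviving price has been offered by the end of phase `b` of the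
improved UCB algorithm. -/
noncomputable def ucbPulls (T b : ℕ) : ℕ :=
  if b = 0 then 0 else ⌈(2 : ℝ) ^ (2 * b + 1) * Real.log (T / (2 : ℝ) ^ (2 * b))⌉₊

/-- Phased version of UCB (improved UCB of Auer and Ortner). -/
noncomputable def improvedUCB (K T : ℕ) : PhasedAlgorithm K where
  numPhases := ⌊Real.logb 2 (T / Real.exp 1) / 2⌋₊ + 1
  phaseEnd b s m := s + (ucbPulls T b - ucbPulls T (b - 1)) * m
  test b := confidenceTest (Real.log (T / (2 : ℝ) ^ (2 * b)) / 2)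

/-- Batched successive elimination of Gao et al., with their tuning parameter equal to `12`, that
is, price `i` is dropped if its empirical mean reward is more than `√(12 log (K T) / n)` below
the best one after `n` pulls of each. -/
noncomputable def batchedElimination (K T : ℕ) : PhasedAlgorithm K where
  numPhases := max 1 ⌈Real.logb 2 (Real.log (Real.exp 1 * T))⌉₊
  phaseEnd b _ _ := ⌈√(Real.exp 1 * T) ^ ((2 : ℝ) - (2 : ℝ) ^ ((1 : ℝ) - b))⌉₊
  test _ := confidenceTest (3 * Real.log (K * T))

/-- Explore-then-commit; `tie` picks one of the prices with the largest empirical mean. -/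
noncomputable def exploreThenCommit (K T : ℕ) (tie : Finset (Fin K) → Fin K) :
    PhasedAlgorithm K where
  numPhases := 2
  phaseEnd _ _ _ := K * ⌈(K : ℝ) ^ (-(2 : ℝ) / 3) * (T : ℝ) ^ ((2 : ℝ) / 3)⌉₊
  test _ _ _ lam :=
    open Classical in {tie (Finset.univ.filter (fun i => ∀ j, lam j ≤ lam i))}

/-- LEAP++: the phased template with the sub-algorithm that fits `M`, `K` and `T`. -/
noncomputable def leapPlusPlus (K T M : ℕ) (tie : Finset (Fin K) → Fin K) : PhasedAlgorithm K :=
  open Classical in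
  if (M : ℝ) ≤ √((K : ℝ) * T) then improvedUCB K T
  else if (M : ℝ) < (K : ℝ) ^ ((1 : ℝ) / 3) * (T : ℝ) ^ ((2 : ℝ) / 3) then batchedElimination K T
  else exploreThenCommit K T tie

/-! ### Stochastic demand and regret -/

/-- Demand over the horizon is in `[0,1]`, independent over time, and the demand under each
fixed price is identically distributed over time. The demands under different prices at the same
time may depend on each other; at most one of them is ever observed. -/
structure IsIIDDemand {K : ℕ} {Ω : Type*} [MeasurableSpace Ω] (μ : Measure Ω) (T : ℕ)
    (D : ℕ → Fin K → Ω → ℝ) : Prop where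
  measurable : ∀ t < T, ∀ k, Measurable (D t k)
  mem_Icc : ∀ t < T, ∀ k, ∀ᵐ ω ∂μ, D t k ω ∈ Set.Icc (0 : ℝ) 1
  indep : iIndepFun (fun (t : Fin T) (ω : Ω) (k : Fin K) => D t k ω) μ
  identDistrib : ∀ s < T, ∀ t < T, ∀ k, IdentDistrib (D s k) (D t k) μ μ

/-- Expected regret of a phased algorithm under price protection of length `M`:
`T · max_k λ_k - 𝔼[revenue]`, where `λ_k = p_k 𝔼[D_0(p_k)]`. -/
noncomputable def regret {K : ℕ} [NeZero K] {Ω : Type*} [MeasurableSpace Ω] (μ : Measure Ω)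
    (T M : ℕ) (p : Fin K → ℝ) (D : ℕ → Fin K → Ω → ℝ) (A : PhasedAlgorithm K) : ℝ :=
  T * Finset.univ.sup' Finset.univ_nonempty (fun k : Fin K => p k * ∫ ω, D 0 k ω ∂μ)
    - ∫ ω, revenue p T M (A.prices T p (fun t k => D t k ω)) (fun t k => D t k ω) ∂μ

/-! ### Blocks of a phase -/

/-! The regret splits into the refunds caused by price protection and the ordinary bandit regret
$\mathbb E\sum_t(\max_k\lambda_k-\lambda_{i_t})$ (`regret_le_integral_add`).

Refunds: prices ascend within a phase, so a customer whose protection window stays inside the phase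
gets nothing back. Hence each phase costs at most `M` (`sum_sub_revenue_le_numPhases_mul`). The last
phase costs nothing, because windows are cut at the horizon; so all refunds together are also
bounded by the start time of the last phase (`sum_sub_revenue_le_time`). The first bound serves the
two elimination algorithms, which have $O(\log KT)$ phases; the second serves explore-then-commit.

Bandit regret: whether a price is offered at time `s` depends only on demands before `s`, so for
each price and each $\theta$ a product of exponential factors over its pulls has expectation at most
one. On the event that the number of pulls is a given `n`, this product is a function of the
empirical mean, and Markov's inequality gives Hoeffding's bound (`measureReal_deviation_le`). While
all means stay within their radii, the best price survives each confidence test and every survivor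
is within four radii of it.

The rest is calibration. For improved UCB, phase `b` resolves gaps of order $2^{-b}$ at cost $K2^b$
up to logarithms, and the analysis stops at $2^{-b}\approx\sqrt{K/T}$; a failing phase has
probability of order $K4^b/T$ and costs at most order $T2^{-b}$, again $K2^b$. For batched
elimination the grid satisfies $u_{b+1}=\sqrt{eT\,u_b}$, so a phase starting at $\tau$, with gaps of
order $\sqrt{K/\tau}$ up to logarithms, costs $\sqrt{KT}$ up to logarithms, whatever $\tau$ is. For
explore-then-commit, $q\approx K^{-2/3}T^{2/3}$ pulls per price balance exploration $Kq$ against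
commitment loss $T/\sqrt q$.

If $K>T$, the trivial bound $T\le\sqrt{KT}$ suffices. -/

lemma slot_mem {K : ℕ} [NeZero K] {P : Finset (Fin K)} (hP : P.Nonempty) {ℓ j : ℕ} (hj : j < ℓ) :
    slot P ℓ j ∈ P := by
  have h : j * P.card / ℓ < (P.sort (· ≤ ·)).length := by
    rw [Finset.length_sort]
    exact Nat.div_lt_of_lt_mul (Nat.mul_lt_mul_of_pos_right hj hP.card_pos)
  rw [slot, List.getD_eq_getElem _ _ h, ← Finset.mem_sort (r := (· ≤ ·))]
  exact List.getElem_mem h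

lemma slot_mono {K : ℕ} [NeZero K] {P : Finset (Fin K)} (hP : P.Nonempty) {ℓ j j' : ℕ}
    (hjj : j ≤ j') (hj : j' < ℓ) : slot P ℓ j ≤ slot P ℓ j' := by
  have h' : j' * P.card / ℓ < (P.sort (· ≤ ·)).length := by
    rw [Finset.length_sort]
    exact Nat.div_lt_of_lt_mul (Nat.mul_lt_mul_of_pos_right hj hP.card_pos)
  have hle : j * P.card / ℓ ≤ j' * P.card / ℓ :=
    Nat.div_le_div_right (Nat.mul_le_mul_right _ hjj)
  rw [slot, slot, List.getD_eq_getElem _ _ h', List.getD_eq_getElem _ _ (hle.trans_lt h')]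
  exact (P.sortedLT_sort.sortedLE).getElem_le_getElem_of_le hle

/-- The witness `r` is the rank of `k` in the sorted list of `P`; it does not depend on the phase
length. -/
lemma exists_slot_eq_iff {K : ℕ} [NeZero K] {P : Finset (Fin K)} {k : Fin K} (hk : k ∈ P) :
    ∃ r < P.card, ∀ ℓ j, j < ℓ → (slot P ℓ j = k ↔ j * P.card / ℓ = r) := by
  obtain ⟨r, hr, hrk⟩ := List.getElem_of_mem ((Finset.mem_sort (r := (· ≤ ·))).2 hk)
  refine ⟨r, by simpa using hr, fun ℓ j hj => ?_⟩
  have h : j * P.card / ℓ < (P.sort (· ≤ ·)).length := by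
    rw [Finset.length_sort]
    exact Nat.div_lt_of_lt_mul (Nat.mul_lt_mul_of_pos_right hj (Finset.card_pos.2 ⟨k, hk⟩))
  rw [slot, List.getD_eq_getElem _ _ h, ← hrk]
  exact (P.sort_nodup (· ≤ ·)).getElem_inj_iff

/-- The block of rank `r` contains all integers from $\lceil r\ell/m\rceil$ up to but excluding
$\lceil (r+1)\ell/m\rceil$, so rounding loses less than one step against $\ell/m$. -/
lemma lt_mul_card_block_add_one {m ℓ r : ℕ} (hr : r < m) :
    ℓ < m * (((Finset.range ℓ).filter (fun j => j * m / ℓ = r)).card + 1) := by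
  rcases Nat.eq_zero_or_pos ℓ with rfl | hℓ
  · simp; omega
  have hm : 0 < m := by omega
  set a := (r * ℓ + (m - 1)) / m with ha
  set b := ((r + 1) * ℓ + (m - 1)) / m with hb
  have ha1 : m * a ≤ r * ℓ + (m - 1) := Nat.mul_div_le _ _
  have ha2 : r * ℓ + (m - 1) < m * (a + 1) := Nat.lt_mul_div_succ _ hm
  have hb1 : m * b ≤ (r + 1) * ℓ + (m - 1) := Nat.mul_div_le _ _
  have hb2 : (r + 1) * ℓ + (m - 1) < m * (b + 1) := Nat.lt_mul_div_succ _ hm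
  have hsub : Finset.Ico a b ⊆ (Finset.range ℓ).filter (fun j => j * m / ℓ = r) := by
    intro j hj
    rw [Finset.mem_Ico] at hj
    have h1 : m * a ≤ m * j := Nat.mul_le_mul_left _ hj.1
    have h2 : m * (j + 1) ≤ m * b := Nat.mul_le_mul_left _ hj.2
    have h3 : j * m < (r + 1) * ℓ := by
      rw [mul_comm j m]; rw [mul_add] at h2; omega
    have h4 : r * ℓ ≤ j * m := by
      rw [mul_comm j m]; rw [mul_add] at ha2; omega
    rw [Finset.mem_filter, Finset.mem_range]
    refine ⟨?_, ?_⟩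
    · have h5 : (r + 1) * ℓ ≤ m * ℓ := Nat.mul_le_mul_right _ hr
      have h6 : j * m < ℓ * m := by rw [mul_comm ℓ m]; omega
      exact Nat.lt_of_mul_lt_mul_right h6
    · exact Nat.div_eq_of_lt_le h4 h3
  have hcard := Finset.card_le_card hsub
  rw [Nat.card_Ico] at hcard
  have h7 : m * b ≤ m * (((Finset.range ℓ).filter (fun j => j * m / ℓ = r)).card + a) :=
    Nat.mul_le_mul_left _ (by omega)
  rw [mul_add] at h7 hb2 ⊢
  rw [add_mul] at hb2
  omega

/-- When the number of prices divides the phase length there is no rounding. Improved UCB and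
explore-then-commit rely on this for deterministic pull counts. -/
lemma card_block_mul {m q r : ℕ} (hr : r < m) :
    ((Finset.range (m * q)).filter (fun j => j * m / (m * q) = r)).card = q := by
  rcases Nat.eq_zero_or_pos q with rfl | hq
  · simp
  have hm : 0 < m := by omega
  have : (Finset.range (m * q)).filter (fun j => j * m / (m * q) = r)
      = Finset.Ico (r * q) ((r + 1) * q) := by
    ext j
    have h1 : j * m / (m * q) = j / q := by
      rw [mul_comm j m, Nat.mul_div_mul_left _ _ hm]
    rw [Finset.mem_filter, Finset.mem_range, Finset.mem_Ico, h1, Nat.div_eq_iff hq]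
    have h5 : (r + 1) * q ≤ m * q := Nat.mul_le_mul_right _ hr
    rw [add_mul] at *
    omega
  rw [this, Nat.card_Ico, add_mul]
  omega

/-- Number of steps at which `k` is offered in a phase of length `ℓ` with plausible set `P`. -/
def slotCount {K : ℕ} [NeZero K] (P : Finset (Fin K)) (ℓ : ℕ) (k : Fin K) : ℕ :=
  ((Finset.range ℓ).filter (fun j => slot P ℓ j = k)).card

lemma exists_slotCount_eq {K : ℕ} [NeZero K] {P : Finset (Fin K)} {k : Fin K} (hk : k ∈ P) :
    ∃ r < P.card, ∀ ℓ,
      slotCount P ℓ k = ((Finset.range ℓ).filter (fun j => j * P.card / ℓ = r)).card := by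
  obtain ⟨r, hr, h⟩ := exists_slot_eq_iff hk
  refine ⟨r, hr, fun ℓ => ?_⟩
  rw [slotCount]
  congr 1
  exact Finset.filter_congr fun j hj => h ℓ j (Finset.mem_range.1 hj)

lemma lt_card_mul_slotCount_add_one {K : ℕ} [NeZero K] {P : Finset (Fin K)} {k : Fin K}
    (hk : k ∈ P) (ℓ : ℕ) : ℓ < P.card * (slotCount P ℓ k + 1) := by
  obtain ⟨r, hr, h⟩ := exists_slotCount_eq hk
  rw [h]
  exact lt_mul_card_block_add_one hr

lemma slotCount_card_mul {K : ℕ} [NeZero K] {P : Finset (Fin K)} {k : Fin K}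
    (hk : k ∈ P) (q : ℕ) : slotCount P (P.card * q) k = q := by
  obtain ⟨r, hr, h⟩ := exists_slotCount_eq hk
  rw [h]
  exact card_block_mul hr

lemma measurable_empMean {K : ℕ} (p : Fin K → ℝ) (i : ℕ → Fin K) (t : ℕ) :
    Measurable (fun d : ℕ → Fin K → ℝ => empMean p d i t) := by
  refine measurable_pi_lambda _ fun k => ?_
  unfold empMean
  fun_prop

/-! ### The run of a phased algorithm -/

/-- The properties of a phased algorithm that the general analysis uses: there is at least one
phase, phases do not overlap, and the tests are measurable and never reject all prices. -/
structure PhasedAlgorithm.IsProper {K : ℕ} [NeZero K] (A : PhasedAlgorithm K) (T : ℕ)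
    (p : Fin K → ℝ) : Prop where
  numPhases_pos : 0 < A.numPhases
  time_le_succ : ∀ d b, b < A.numPhases → (A.run T p d b).time ≤ (A.run T p d (b + 1)).time
  test_nonempty : ∀ b P N lam, P.Nonempty → (A.test b P N lam).Nonempty
  measurableSet_test : ∀ b P N Q, MeasurableSet {lam | A.test b P N lam = Q}

namespace PhasedAlgorithm

variable {K : ℕ} [NeZero K] (A : PhasedAlgorithm K) (T : ℕ) (p : Fin K → ℝ)
  (d : ℕ → Fin K → ℝ)

lemma run_zero_time : (A.run T p d 0).time = 0 := rfl

lemma run_zero_plausible : (A.run T p d 0).plausible = Finset.univ := rfl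

lemma run_succ_time (b : ℕ) : (A.run T p d (b + 1)).time =
    if b + 1 = A.numPhases then T
    else min (A.phaseEnd (b + 1) (A.run T p d b).time (A.run T p d b).plausible.card) T := rfl

lemma run_succ_plausible (b : ℕ) : (A.run T p d (b + 1)).plausible =
    A.test (b + 1) (A.run T p d b).plausible
      (pullCount (A.run T p d (b + 1)).choice (A.run T p d (b + 1)).time)
      (empMean p d (A.run T p d (b + 1)).choice (A.run T p d (b + 1)).time) := rfl

lemma run_succ_choice (b s : ℕ) : (A.run T p d (b + 1)).choice s =
    if s < (A.run T p d b).time then (A.run T p d b).choice s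
    else slot (A.run T p d b).plausible ((A.run T p d (b + 1)).time - (A.run T p d b).time)
      (s - (A.run T p d b).time) := rfl

lemma run_time_le (b : ℕ) : (A.run T p d b).time ≤ T := by
  cases b with
  | zero => simp [run_zero_time]
  | succ b => rw [run_succ_time]; split_ifs <;> simp

variable {A T p}

lemma IsProper.run_numPhases_time (hA : A.IsProper T p) :
    (A.run T p d A.numPhases).time = T := by
  obtain ⟨b, hb⟩ := Nat.exists_eq_succ_of_ne_zero hA.numPhases_pos.ne'
  rw [hb, Nat.succ_eq_add_one, run_succ_time, if_pos hb.symm]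

lemma IsProper.plausible_nonempty (hA : A.IsProper T p) (b : ℕ) :
    (A.run T p d b).plausible.Nonempty := by
  induction b with
  | zero => exact Finset.univ_nonempty
  | succ b ih => rw [run_succ_plausible]; exact hA.test_nonempty _ _ _ _ ih

lemma IsProper.time_le_time (hA : A.IsProper T p) {b c : ℕ} (hbc : b ≤ c)
    (hc : c ≤ A.numPhases) : (A.run T p d b).time ≤ (A.run T p d c).time := by
  induction c, hbc using Nat.le_induction with
  | base => rfl
  | succ c _ ih => exact (ih (by omega)).trans (hA.time_le_succ d c (by omega))

lemma IsProper.choice_eq_choice (hA : A.IsProper T p) {b c : ℕ} (hbc : b ≤ c)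
    (hc : c ≤ A.numPhases) {s : ℕ} (hs : s < (A.run T p d b).time) :
    (A.run T p d c).choice s = (A.run T p d b).choice s := by
  induction c, hbc using Nat.le_induction with
  | base => rfl
  | succ c hbc ih =>
    rw [run_succ_choice, if_pos (hs.trans_le (hA.time_le_time d hbc (by omega))), ih (by omega)]

lemma IsProper.prices_eq_choice (hA : A.IsProper T p) {b : ℕ} (hb : b ≤ A.numPhases) {s : ℕ}
    (hs : s < (A.run T p d b).time) : A.prices T p d s = (A.run T p d b).choice s :=
  hA.choice_eq_choice d hb le_rfl hs

lemma IsProper.prices_eq_slot (hA : A.IsProper T p) {b : ℕ} (hb : b < A.numPhases) {s : ℕ}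
    (hs : (A.run T p d b).time ≤ s) (hs' : s < (A.run T p d (b + 1)).time) :
    A.prices T p d s = slot (A.run T p d b).plausible
      ((A.run T p d (b + 1)).time - (A.run T p d b).time) (s - (A.run T p d b).time) := by
  rw [hA.prices_eq_choice d (b := b + 1) hb hs', run_succ_choice, if_neg (not_lt.2 hs)]

lemma IsProper.prices_mem_plausible (hA : A.IsProper T p) {b : ℕ} (hb : b < A.numPhases) {s : ℕ}
    (hs : (A.run T p d b).time ≤ s) (hs' : s < (A.run T p d (b + 1)).time) :
    A.prices T p d s ∈ (A.run T p d b).plausible := by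
  rw [hA.prices_eq_slot d hb hs hs']
  exact slot_mem (hA.plausible_nonempty d b) (by omega)

lemma IsProper.prices_mono_in_phase (hA : A.IsProper T p) {b : ℕ} (hb : b < A.numPhases)
    {s s' : ℕ} (hs : (A.run T p d b).time ≤ s) (hss : s ≤ s')
    (hs' : s' < (A.run T p d (b + 1)).time) : A.prices T p d s ≤ A.prices T p d s' := by
  rw [hA.prices_eq_slot d hb hs (by omega), hA.prices_eq_slot d hb (hs.trans hss) hs']
  exact slot_mono (hA.plausible_nonempty d b) (by omega) (by omega)

/-- Pulls at the end of a phase: those before it, and those in its block. -/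
lemma IsProper.pullCount_succ (hA : A.IsProper T p) {b : ℕ} (hb : b < A.numPhases) (k : Fin K) :
    pullCount (A.run T p d (b + 1)).choice (A.run T p d (b + 1)).time k
      = pullCount (A.run T p d b).choice (A.run T p d b).time k
        + slotCount (A.run T p d b).plausible
          ((A.run T p d (b + 1)).time - (A.run T p d b).time) k := by
  have hle := hA.time_le_succ d b hb
  simp only [pullCount, slotCount, Finset.card_filter]
  rw [← Finset.sum_range_add_sum_Ico _ hle, Finset.sum_Ico_eq_sum_range]
  congr 1
  · refine Finset.sum_congr rfl fun s hs => ?_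
    rw [run_succ_choice, if_pos (Finset.mem_range.1 hs)]
  · refine Finset.sum_congr rfl fun s hs => ?_
    have hc : (A.run T p d (b + 1)).choice ((A.run T p d b).time + s)
        = slot (A.run T p d b).plausible
          ((A.run T p d (b + 1)).time - (A.run T p d b).time) s := by
      rw [run_succ_choice, if_neg (by omega), Nat.add_sub_cancel_left]
    rw [hc]

/-- Sum over the horizon, split into phases. -/
lemma IsProper.sum_range_time (hA : A.IsProper T p) (f : ℕ → ℝ) {b : ℕ} (hb : b ≤ A.numPhases) :
    ∑ t ∈ Finset.range (A.run T p d b).time, f t = ∑ c ∈ Finset.range b,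
      ∑ t ∈ Finset.Ico (A.run T p d c).time (A.run T p d (c + 1)).time, f t := by
  induction b with
  | zero => simp [run_zero_time]
  | succ b ih =>
    rw [Finset.sum_range_succ, ← ih (by omega),
      Finset.sum_range_add_sum_Ico _ (hA.time_le_succ d b hb)]

lemma IsProper.sum_range_horizon (hA : A.IsProper T p) (f : ℕ → ℝ) :
    ∑ t ∈ Finset.range T, f t = ∑ c ∈ Finset.range A.numPhases,
      ∑ t ∈ Finset.Ico (A.run T p d c).time (A.run T p d (c + 1)).time, f t := by
  have := hA.sum_range_time d f le_rfl
  rwa [hA.run_numPhases_time] at this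

/-- The prices that are offered before time `s`, and whether phase `b` is over by then, depend only
on the demands before time `s`. -/
lemma IsProper.run_congr (hA : A.IsProper T p) {d d' : ℕ → Fin K → ℝ} {s : ℕ}
    (h : ∀ r < s, d r = d' r) {b : ℕ} (hb : b ≤ A.numPhases) :
    ((A.run T p d b).time ≤ s ∧ A.run T p d b = A.run T p d' b) ∨
    (s < (A.run T p d b).time ∧ s < (A.run T p d' b).time ∧
      ∀ r ≤ s, (A.run T p d b).choice r = (A.run T p d' b).choice r) := by
  induction b with
  | zero => exact Or.inl ⟨Nat.zero_le _, rfl⟩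
  | succ b ih =>
    rcases ih (by omega) with ⟨hs, heq⟩ | ⟨hs, hs', heq⟩
    · have htime : (A.run T p d (b + 1)).time = (A.run T p d' (b + 1)).time := by
        rw [run_succ_time, run_succ_time, heq]
      have hchoice : (A.run T p d (b + 1)).choice = (A.run T p d' (b + 1)).choice := by
        funext r
        rw [run_succ_choice, run_succ_choice, htime, heq]
      by_cases hle : (A.run T p d (b + 1)).time ≤ s
      · left
        refine ⟨hle, ?_⟩
        have hpl : (A.run T p d (b + 1)).plausible = (A.run T p d' (b + 1)).plausible := by
          rw [run_succ_plausible, run_succ_plausible, ← htime, ← hchoice, heq]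
          congr 1
          funext k
          unfold empMean
          congr 1
          refine Finset.sum_congr rfl fun r hr => ?_
          rw [h r (by simp at hr; omega)]
        cases h1 : A.run T p d (b + 1)
        cases h2 : A.run T p d' (b + 1)
        simp only [h1, h2] at htime hchoice hpl
        rw [htime, hchoice, hpl]
      · right
        exact ⟨by omega, by omega, fun r _ => by rw [hchoice]⟩
    · right
      have h1 := hA.time_le_succ d b hb
      have h2 := hA.time_le_succ d' b hb
      refine ⟨by omega, by omega, fun r hr => ?_⟩
      rw [run_succ_choice, run_succ_choice, if_pos (by omega), if_pos (by omega), heq r hr]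

/-- The event that price `k` is offered at time `s`, before the end of phase `b`, depends only on
the demands before time `s`. -/
lemma IsProper.offered_congr (hA : A.IsProper T p) {d d' : ℕ → Fin K → ℝ} {s : ℕ}
    (h : ∀ r < s, d r = d' r) {b : ℕ} (hb : b ≤ A.numPhases) (k : Fin K) :
    (s < (A.run T p d b).time ∧ (A.run T p d b).choice s = k) ↔
    (s < (A.run T p d' b).time ∧ (A.run T p d' b).choice s = k) := by
  rcases hA.run_congr h hb with ⟨_, heq⟩ | ⟨hs, hs', heq⟩
  · rw [heq]
  · rw [heq s le_rfl]; tauto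

lemma IsProper.run_congr_horizon (hA : A.IsProper T p) {d d' : ℕ → Fin K → ℝ}
    (h : ∀ r < T, d r = d' r) {b : ℕ} (hb : b ≤ A.numPhases) :
    A.run T p d b = A.run T p d' b := by
  rcases hA.run_congr h hb with ⟨_, heq⟩ | ⟨hs, _, _⟩
  · exact heq
  · exact absurd (A.run_time_le T p d b) (by omega)

/-! ### Measurability -/

/-- Given the previous state, the new time and choices are determined and only the plausible set can
vary, over finitely many values. Measurability of the run then reduces to finite case distinctions.
-/
lemma finite_range_run (b : ℕ) : (Set.range fun d => A.run T p d b).Finite := by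
  induction b with
  | zero =>
    refine Set.Finite.subset (Set.finite_singleton (⟨0, Finset.univ, fun _ => 0⟩ : PhaseState K)) ?_
    rintro _ ⟨d, rfl⟩
    rfl
  | succ b ih =>
    let e : PhaseState K → ℕ := fun S => if b + 1 = A.numPhases then T
      else min (A.phaseEnd (b + 1) S.time S.plausible.card) T
    let c : PhaseState K → ℕ → Fin K := fun S s =>
      if s < S.time then S.choice s else slot S.plausible (e S - S.time) (s - S.time)
    refine ((ih.prod (Set.finite_univ (α := Finset (Fin K)))).image
      (fun x => (⟨e x.1, x.2, c x.1⟩ : PhaseState K))).subset ?_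
    rintro _ ⟨d, rfl⟩
    exact ⟨(A.run T p d b, (A.run T p d (b + 1)).plausible), ⟨⟨d, rfl⟩, trivial⟩, rfl⟩

lemma IsProper.measurableSet_run_eq (hA : A.IsProper T p) (b : ℕ) (S : PhaseState K) :
    MeasurableSet {d | A.run T p d b = S} := by
  induction b generalizing S with
  | zero => exact MeasurableSet.const ((⟨0, Finset.univ, fun _ => 0⟩ : PhaseState K) = S)
  | succ b ih =>
    let e : PhaseState K → ℕ := fun S => if b + 1 = A.numPhases then T
      else min (A.phaseEnd (b + 1) S.time S.plausible.card) T
    let c : PhaseState K → ℕ → Fin K := fun S s =>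
      if s < S.time then S.choice s else slot S.plausible (e S - S.time) (s - S.time)
    -- Once the previous state is fixed to `R`, schedule and pull counts are constants, and only the
    -- empirical means still depend on the demands.
    have : {d | A.run T p d (b + 1) = S} = ⋃ R ∈ Set.range fun d => A.run T p d b,
        {d | A.run T p d b = R} ∩ {d | e R = S.time ∧ c R = S.choice ∧
          A.test (b + 1) R.plausible (pullCount (c R) (e R)) (empMean p d (c R) (e R))
            = S.plausible} := by
      ext d
      simp only [Set.mem_ofPred_eq, Set.mem_iUnion, Set.mem_inter_iff, exists_prop]
      constructor
      · rintro rfl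
        exact ⟨A.run T p d b, ⟨d, rfl⟩, rfl, rfl, rfl, rfl⟩
      · rintro ⟨R, -, rfl, h1, h2, h3⟩
        cases S
        exact (PhaseState.mk.injEq _ _ _ _ _ _).symm ▸ ⟨h1, h3, h2⟩
    rw [this]
    refine MeasurableSet.biUnion (finite_range_run b).countable fun R _ => (ih R).inter ?_
    exact (MeasurableSet.const _).inter ((MeasurableSet.const _).inter
      (measurable_empMean p _ _ (hA.measurableSet_test _ _ _ _)))

/-- Every property of the state is an event. -/
lemma IsProper.measurableSet_run (hA : A.IsProper T p) (b : ℕ) (Q : PhaseState K → Prop) :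
    MeasurableSet {d | Q (A.run T p d b)} := by
  have : {d | Q (A.run T p d b)} = ⋃ R ∈ {R | R ∈ (Set.range fun d => A.run T p d b) ∧ Q R},
      {d | A.run T p d b = R} := by
    ext d
    simp only [Set.mem_ofPred_eq, Set.mem_iUnion, exists_prop]
    exact ⟨fun h => ⟨_, ⟨⟨d, rfl⟩, h⟩, rfl⟩, fun ⟨R, ⟨_, h⟩, h'⟩ => h' ▸ h⟩
  rw [this]
  exact MeasurableSet.biUnion ((finite_range_run b).countable.mono fun _ h => h.1)
    fun R _ => hA.measurableSet_run_eq b R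

/-- A measurable function of the state and the demands. -/
lemma IsProper.measurable_run (hA : A.IsProper T p) (b : ℕ)
    {f : PhaseState K → (ℕ → Fin K → ℝ) → ℝ} (hf : ∀ R, Measurable (f R)) :
    Measurable fun d => f (A.run T p d b) d := by
  intro s hs
  have : (fun d => f (A.run T p d b) d) ⁻¹' s = ⋃ R ∈ Set.range fun d => A.run T p d b,
      {d | A.run T p d b = R} ∩ (f R) ⁻¹' s := by
    ext d
    simp only [Set.mem_preimage, Set.mem_iUnion, exists_prop, Set.mem_inter_iff, Set.mem_ofPred_eq]
    exact ⟨fun h => ⟨_, ⟨d, rfl⟩, rfl, h⟩, fun ⟨R, _, h, h'⟩ => h ▸ h'⟩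
  rw [this]
  exact MeasurableSet.biUnion (finite_range_run b).countable
    fun R _ => (hA.measurableSet_run_eq b R).inter (hf R hs)

end PhasedAlgorithm

/-! ### The cost of price protection -/

lemma finalPrice_nonneg {K : ℕ} {p : Fin K → ℝ} (hp : ∀ k, p k ∈ Set.Icc (0 : ℝ) 1) (T M : ℕ)
    (i : ℕ → Fin K) (t : ℕ) : 0 ≤ finalPrice p T M i t :=
  Finset.le_inf' _ _ fun _ _ => (hp _).1

lemma finalPrice_le_one {K : ℕ} {p : Fin K → ℝ} (hp : ∀ k, p k ∈ Set.Icc (0 : ℝ) 1) (T M : ℕ)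
    (i : ℕ → Fin K) (t : ℕ) : finalPrice p T M i t ≤ 1 :=
  (Finset.inf'_le _ (Finset.left_mem_Icc.2 (Nat.le_add_right t M))).trans (hp _).2

lemma sub_finalPrice_mul_le_one {K : ℕ} {p : Fin K → ℝ} (hp : ∀ k, p k ∈ Set.Icc (0 : ℝ) 1)
    (T M : ℕ) (i : ℕ → Fin K) (t : ℕ) {x : ℝ} (hx : x ∈ Set.Icc (0 : ℝ) 1) (k : Fin K) :
    p k * x - finalPrice p T M i t * x ≤ 1 := by
  have h1 := finalPrice_nonneg hp T M i t
  have h2 : p k * x ≤ 1 := mul_le_one₀ (hp k).2 hx.1 hx.2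
  nlinarith [mul_nonneg h1 hx.1]

namespace PhasedAlgorithm

variable {K : ℕ} [NeZero K] {A : PhasedAlgorithm K} {T : ℕ} {p : Fin K → ℝ}

/-- No refund is due if the protection period ends within the phase. -/
lemma IsProper.le_finalPrice (hA : A.IsProper T p) (hp : Monotone p) (d : ℕ → Fin K → ℝ) (M : ℕ)
    {b : ℕ} (hb : b < A.numPhases) {t : ℕ} (ht : (A.run T p d b).time ≤ t)
    (htT : t < (A.run T p d (b + 1)).time)
    (htM : t + M < (A.run T p d (b + 1)).time ∨ b + 1 = A.numPhases) :
    p (A.prices T p d t) ≤ finalPrice p T M (A.prices T p d) t := by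
  refine Finset.le_inf' _ _ fun s hs => hp ?_
  rw [Finset.mem_Icc] at hs
  have hT := A.run_time_le T p d (b + 1)
  refine hA.prices_mono_in_phase d hb ht (by omega) ?_
  rcases htM with h | h
  · omega
  -- In the last phase, clipping the window at `T - 1` keeps it inside the phase.
  · have : (A.run T p d (b + 1)).time = T := by rw [h]; exact hA.run_numPhases_time d
    omega

/-- Only the customers of the last `M` steps of the phase can see a price of a later phase, and each
of them costs at most one. -/
lemma IsProper.sum_phase_sub_finalPrice_le (hA : A.IsProper T p) (hp : Monotone p)
    (hp1 : ∀ k, p k ∈ Set.Icc (0 : ℝ) 1) {d : ℕ → Fin K → ℝ}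
    (hd : ∀ t k, d t k ∈ Set.Icc (0 : ℝ) 1) (M : ℕ) {b : ℕ} (hb : b < A.numPhases) :
    ∑ t ∈ Finset.Ico (A.run T p d b).time (A.run T p d (b + 1)).time,
      (p (A.prices T p d t) * d t (A.prices T p d t)
        - finalPrice p T M (A.prices T p d) t * d t (A.prices T p d t)) ≤ M := by
  set u := (A.run T p d b).time
  set v := (A.run T p d (b + 1)).time
  calc _ ≤ ∑ t ∈ Finset.Ico u v, (if v ≤ t + M then (1 : ℝ) else 0) := by
        refine Finset.sum_le_sum fun t ht => ?_
        rw [Finset.mem_Ico] at ht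
        split_ifs with h
        · exact sub_finalPrice_mul_le_one hp1 _ _ _ _ (hd _ _) _
        · have := hA.le_finalPrice hp d M hb ht.1 ht.2 (Or.inl (by omega))
          exact sub_nonpos.2 (mul_le_mul_of_nonneg_right this (hd _ _).1)
    _ = (((Finset.Ico u v).filter (fun t => v ≤ t + M)).card : ℝ) := by
        rw [Finset.sum_boole]
    _ ≤ M := by
        have hsub : (Finset.Ico u v).filter (fun t => v ≤ t + M) ⊆ Finset.Ico (v - M) v := by
          intro t ht
          simp only [Finset.mem_filter, Finset.mem_Ico] at ht ⊢
          omega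
        have := Finset.card_le_card hsub
        rw [Nat.card_Ico] at this
        exact_mod_cast this.trans (by omega)

/-- Refunds cost at most `M` per phase. -/
lemma IsProper.sum_sub_revenue_le_numPhases_mul (hA : A.IsProper T p) (hp : Monotone p)
    (hp1 : ∀ k, p k ∈ Set.Icc (0 : ℝ) 1) {d : ℕ → Fin K → ℝ}
    (hd : ∀ t k, d t k ∈ Set.Icc (0 : ℝ) 1) (M : ℕ) :
    ∑ t ∈ Finset.range T, p (A.prices T p d t) * d t (A.prices T p d t)
      - revenue p T M (A.prices T p d) d ≤ A.numPhases * M := by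
  rw [revenue, ← Finset.sum_sub_distrib, hA.sum_range_horizon d]
  refine (Finset.sum_le_sum fun b hb =>
    hA.sum_phase_sub_finalPrice_le hp hp1 hd M (Finset.mem_range.1 hb)).trans ?_
  simp

/-- Refunds are due before the last phase only. -/
lemma IsProper.sum_sub_revenue_le_time (hA : A.IsProper T p) (hp : Monotone p)
    (hp1 : ∀ k, p k ∈ Set.Icc (0 : ℝ) 1) {d : ℕ → Fin K → ℝ}
    (hd : ∀ t k, d t k ∈ Set.Icc (0 : ℝ) 1) (M : ℕ) {b : ℕ} (hb : b + 1 = A.numPhases) :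
    ∑ t ∈ Finset.range T, p (A.prices T p d t) * d t (A.prices T p d t)
      - revenue p T M (A.prices T p d) d ≤ (A.run T p d b).time := by
  have hT : (A.run T p d (b + 1)).time = T := by rw [hb]; exact hA.run_numPhases_time d
  rw [revenue, ← Finset.sum_sub_distrib,
    ← Finset.sum_range_add_sum_Ico _ (A.run_time_le T p d b)]
  have h1 : ∑ t ∈ Finset.range (A.run T p d b).time,
      (p (A.prices T p d t) * d t (A.prices T p d t)
        - finalPrice p T M (A.prices T p d) t * d t (A.prices T p d t))
      ≤ (A.run T p d b).time := by
    refine (Finset.sum_le_sum fun t _ =>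
      sub_finalPrice_mul_le_one hp1 T M (A.prices T p d) t (hd t _) _).trans ?_
    simp
  have h2 : ∑ t ∈ Finset.Ico (A.run T p d b).time T,
      (p (A.prices T p d t) * d t (A.prices T p d t)
        - finalPrice p T M (A.prices T p d) t * d t (A.prices T p d t)) ≤ 0 := by
    refine Finset.sum_nonpos fun t ht => ?_
    rw [Finset.mem_Ico] at ht
    have := hA.le_finalPrice hp d M (b := b) (by omega) ht.1 (by omega) (Or.inr hb)
    exact sub_nonpos.2 (mul_le_mul_of_nonneg_right this (hd _ _).1)
  linarith

end PhasedAlgorithm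
open scoped ENNReal

/-! ### Demand that is independent over time -/

/-- Demand in `[0,1]` at all times that is independent over the horizon, with means `m`. -/
structure IsIndepDemand {K : ℕ} {Ω : Type*} [MeasurableSpace Ω] (μ : Measure Ω) (T : ℕ)
    (D : ℕ → Fin K → Ω → ℝ) (m : Fin K → ℝ) : Prop where
  measurable : ∀ t k, Measurable (D t k)
  mem_Icc : ∀ t k ω, D t k ω ∈ Set.Icc (0 : ℝ) 1
  indep : iIndepFun (fun (t : Fin T) (ω : Ω) (k : Fin K) => D t k ω) μ
  integral_eq : ∀ t < T, ∀ k, ∫ ω, D t k ω ∂μ = m k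

section

variable {K : ℕ} {Ω : Type*} [MeasurableSpace Ω] {μ : Measure Ω} {T : ℕ}
  {D : ℕ → Fin K → Ω → ℝ} {m : Fin K → ℝ}

lemma IsIndepDemand.measurable_table (hD : IsIndepDemand μ T D m) :
    Measurable fun ω t k => D t k ω :=
  measurable_pi_lambda _ fun t => measurable_pi_lambda _ fun k => hD.measurable t k

/-- A function of the demands before time `t` is independent of the demand at time `t`. -/
lemma IsIndepDemand.indepFun_past (hD : IsIndepDemand μ T D m) {β : Type*} [MeasurableSpace β]
    {g : (ℕ → Fin K → ℝ) → β} (hg : Measurable g) {t : ℕ} (ht : t < T)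
    (hloc : ∀ d d' : ℕ → Fin K → ℝ, (∀ s < t, d s = d' s) → g d = g d') :
    IndepFun (fun ω => g fun s k => D s k ω) (fun ω k => D t k ω) μ := by
  let S : Finset (Fin T) := Finset.univ.filter fun s => s.val < t
  let S' : Finset (Fin T) := {⟨t, ht⟩}
  have hdisj : Disjoint S S' := by
    rw [Finset.disjoint_singleton_right]
    simp [S]
  have hind := hD.indep.indepFun_finset S S' hdisj
    (fun s => measurable_pi_lambda _ fun k => hD.measurable s k)
  -- The table is rebuilt from its rows before `t` and padded with zeros; by `hloc` the padding does
  -- not affect `g`.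
  let φ : (S → Fin K → ℝ) → β := fun x => g fun s k =>
    if h : s < t then x ⟨⟨s, h.trans ht⟩, by simp [S, h]⟩ k else 0
  have hφ : Measurable φ := by
    refine hg.comp (measurable_pi_lambda _ fun s => measurable_pi_lambda _ fun k => ?_)
    split_ifs
    · fun_prop
    · exact measurable_const
  let ψ : (S' → Fin K → ℝ) → Fin K → ℝ := fun x => x ⟨⟨t, ht⟩, by simp [S']⟩
  have hψ : Measurable ψ := measurable_pi_apply _
  have := hind.comp hφ hψ
  convert this using 1
  · funext ω
    refine hloc _ _ fun s hs => ?_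
    funext k
    simp [hs]
  · rfl

variable [IsProbabilityMeasure μ]

/-- Factor of the exponential supermartingale of price `k`. -/
noncomputable def expFactor (c θ ℓ : ℝ) (I : Prop) (x : ℝ) : ℝ≥0∞ :=
  open Classical in
  if I then ENNReal.ofReal (Real.exp (θ * (c * x - ℓ) - θ ^ 2 / 8)) else 1

/-- Hoeffding's lemma: a centred variable with range of length one is subgaussian with variance
proxy 1/4. -/
lemma IsIndepDemand.lintegral_exp_le_one (hD : IsIndepDemand μ T D m) {c : ℝ}
    (hc : c ∈ Set.Icc (0 : ℝ) 1) (k : Fin K) (θ : ℝ) {t : ℕ} (ht : t < T) :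
    ∫⁻ ω, ENNReal.ofReal (Real.exp (θ * (c * D t k ω - c * m k) - θ ^ 2 / 8)) ∂μ ≤ 1 := by
  have hI : ∀ ω, c * D t k ω ∈ Set.Icc (0 : ℝ) 1 := fun ω =>
    ⟨mul_nonneg hc.1 (hD.mem_Icc t k ω).1,
      mul_le_one₀ hc.2 (hD.mem_Icc t k ω).1 (hD.mem_Icc t k ω).2⟩
  have hm : Measurable fun ω => c * D t k ω := (hD.measurable t k).const_mul c
  have hsub := hasSubgaussianMGF_of_mem_Icc hm.aemeasurable (Filter.Eventually.of_forall hI)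
    (μ := μ)
  have hmean : μ[fun ω => c * D t k ω] = c * m k := by
    rw [integral_const_mul, hD.integral_eq t ht]
  rw [hmean] at hsub
  have h1 := hsub.mgf_le θ
  have h2 := hsub.integrable_exp_mul θ
  have h3 : (fun ω => Real.exp (θ * (c * D t k ω - c * m k) - θ ^ 2 / 8))
      = fun ω => Real.exp (θ * (c * D t k ω - c * m k)) * Real.exp (-(θ ^ 2 / 8)) := by
    funext ω; rw [← Real.exp_add, sub_eq_add_neg]
  rw [← ofReal_integral_eq_lintegral_ofReal, ENNReal.ofReal_le_one, h3, integral_mul_const]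
  · have h4 : ∫ ω, Real.exp (θ * (c * D t k ω - c * m k)) ∂μ ≤ Real.exp (θ ^ 2 / 8) := by
      refine h1.trans (Real.exp_le_exp.2 (le_of_eq ?_))
      simp
      ring
    calc _ ≤ Real.exp (θ ^ 2 / 8) * Real.exp (-(θ ^ 2 / 8)) := by gcongr
      _ = 1 := by rw [← Real.exp_add]; simp
  · rw [h3]; exact h2.mul_const _
  · exact Filter.Eventually.of_forall fun ω => (Real.exp_pos _).le

lemma measurable_expFactor {c θ ℓ : ℝ} {I : (ℕ → Fin K → ℝ) → Prop}
    (hI : MeasurableSet {d | I d}) (s : ℕ) (k : Fin K) :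
    Measurable fun d : ℕ → Fin K → ℝ => expFactor c θ ℓ (I d) (d s k) := by
  unfold expFactor
  refine Measurable.ite hI ?_ measurable_const
  fun_prop

/-- The exponential supermartingale of a price that is offered at predictable times. -/
lemma IsIndepDemand.lintegral_prod_expFactor_le_one (hD : IsIndepDemand μ T D m) {c : ℝ}
    (hc : c ∈ Set.Icc (0 : ℝ) 1) (k : Fin K) (θ : ℝ) {I : ℕ → (ℕ → Fin K → ℝ) → Prop}
    (hI : ∀ s, MeasurableSet {d | I s d})
    (hloc : ∀ s, ∀ d d' : ℕ → Fin K → ℝ, (∀ r < s, d r = d' r) → (I s d ↔ I s d'))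
    {t : ℕ} (ht : t ≤ T) :
    ∫⁻ ω, ∏ s ∈ Finset.range t,
      expFactor c θ (c * m k) (I s fun t k => D t k ω) (D s k ω) ∂μ ≤ 1 := by
  classical
  induction t with
  | zero => simp
  | succ t ih =>
    let U : (ℕ → Fin K → ℝ) → ℝ≥0∞ := fun d => ∏ s ∈ Finset.range t,
      expFactor c θ (c * m k) (I s d) (d s k)
    let V : (Fin K → ℝ) → ℝ≥0∞ := fun x =>
      ENNReal.ofReal (Real.exp (θ * (c * x k - c * m k) - θ ^ 2 / 8))
    have hU : Measurable U :=
      Finset.measurable_fun_prod _ fun s _ => measurable_expFactor (hI s) s k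
    have hV : Measurable V := by fun_prop
    have hUI : Measurable fun d => if I t d then U d else 0 :=
      Measurable.ite (hI t) hU measurable_const
    have hUI' : Measurable fun d => if I t d then 0 else U d :=
      Measurable.ite (hI t) measurable_const hU
    have hind := hD.indepFun_past hUI (t := t) (by omega) (by
      intro d d' h
      have hUU : U d = U d' := Finset.prod_congr rfl fun s hs => by
        rw [Finset.mem_range] at hs
        rw [h s hs]
        congr 1
        exact propext (hloc s d d' fun r hr => h r (hr.trans hs))
      simp only [hUU, hloc t d d' h])
    have hind' := hind.comp measurable_id hV
    have htab := hD.measurable_table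
    have hrow : Measurable fun ω k => D t k ω := measurable_pi_lambda _ fun k => hD.measurable t k
    have hUI1 : Measurable fun ω =>
        if I t (fun t k => D t k ω) then 0 else U fun t k => D t k ω := hUI'.comp htab
    -- If the price is not offered at time `t`, the new factor is 1. If it is, the new factor is `V`
    -- of the current demand, which is independent of the past product restricted to that past
    -- event.
    have hsplit : ∀ ω, ∏ s ∈ Finset.range (t + 1),
        expFactor c θ (c * m k) (I s fun t k => D t k ω) (D s k ω)
        = (if I t (fun t k => D t k ω) then 0 else U fun t k => D t k ω)
          + (if I t (fun t k => D t k ω) then U fun t k => D t k ω else 0)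
            * V fun k => D t k ω := by
      intro ω
      rw [Finset.prod_range_succ]
      by_cases h : I t fun t k => D t k ω
      · simp [h, expFactor, U, V]
      · simp [h, expFactor, U]
    calc _ = ∫⁻ ω, (if I t (fun t k => D t k ω) then 0 else U fun t k => D t k ω) ∂μ
          + ∫⁻ ω, (if I t (fun t k => D t k ω) then U fun t k => D t k ω else 0)
            * V (fun k => D t k ω) ∂μ := by
          rw [← lintegral_add_left hUI1]
          exact lintegral_congr hsplit
      _ = ∫⁻ ω, (if I t (fun t k => D t k ω) then 0 else U fun t k => D t k ω) ∂μ
          + (∫⁻ ω, (if I t (fun t k => D t k ω) then U fun t k => D t k ω else 0) ∂μ)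
            * ∫⁻ ω, V (fun k => D t k ω) ∂μ := by
          congr 1
          exact lintegral_mul_eq_lintegral_mul_lintegral_of_indepFun (hUI.comp htab)
            (hV.comp hrow) hind'
      _ ≤ ∫⁻ ω, (if I t (fun t k => D t k ω) then 0 else U fun t k => D t k ω) ∂μ
          + (∫⁻ ω, (if I t (fun t k => D t k ω) then U fun t k => D t k ω else 0) ∂μ) * 1 := by
          gcongr
          exact hD.lintegral_exp_le_one hc k θ (by omega)
      _ = ∫⁻ ω, U (fun t k => D t k ω) ∂μ := by
          rw [mul_one, ← lintegral_add_left hUI1]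
          refine lintegral_congr fun ω => ?_
          by_cases h : I t fun t k => D t k ω <;> simp [h]
      _ ≤ 1 := ih (by omega)

end

/-! ### Concentration of empirical means at the end of a phase. -/

namespace PhasedAlgorithm

variable {K : ℕ} [NeZero K] {A : PhasedAlgorithm K} {T : ℕ} {p : Fin K → ℝ}

/-- Factors at steps where `k` is not offered, or after the phase, equal 1; the remaining `n`
exponents add up to an affine function of the empirical mean. -/
lemma prod_expFactor_eq {b : ℕ} {d : ℕ → Fin K → ℝ} {k : Fin K} {n : ℕ} (hn : 0 < n)
    (hN : pullCount (A.run T p d b).choice (A.run T p d b).time k = n) (θ ℓ : ℝ) :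
    ∏ s ∈ Finset.range T, expFactor (p k) θ ℓ
        (s < (A.run T p d b).time ∧ (A.run T p d b).choice s = k) (d s k)
      = ENNReal.ofReal (Real.exp
          (n * (θ * (empMean p d (A.run T p d b).choice (A.run T p d b).time k - ℓ)
            - θ ^ 2 / 8))) := by
  classical
  have hT := A.run_time_le T p d b
  set τ := (A.run T p d b).time
  set c := (A.run T p d b).choice
  have hn' : (n : ℝ) ≠ 0 := by positivity
  have hset : (Finset.range T).filter (fun s => s < τ ∧ c s = k)
      = (Finset.range τ).filter (fun s => c s = k) := by
    ext s
    simp only [Finset.mem_filter, Finset.mem_range]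
    omega
  have hprod : ∏ s ∈ Finset.range T, expFactor (p k) θ ℓ (s < τ ∧ c s = k) (d s k)
      = ∏ s ∈ (Finset.range T).filter (fun s => s < τ ∧ c s = k),
        ENNReal.ofReal (Real.exp (θ * (p k * d s k - ℓ) - θ ^ 2 / 8)) := by
    rw [Finset.prod_filter]
    refine Finset.prod_congr rfl fun s _ => ?_
    unfold expFactor
    congr
  rw [hprod, hset, ← ENNReal.ofReal_prod_of_nonneg fun _ _ => (Real.exp_pos _).le, ← Real.exp_sum]
  congr 2
  rw [Finset.sum_sub_distrib, ← Finset.mul_sum, Finset.sum_sub_distrib, Finset.sum_const,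
    Finset.sum_const]
  rw [show ((Finset.range τ).filter (fun s => c s = k)).card = n from hN]
  have hsum : ∑ s ∈ (Finset.range τ).filter (fun s => c s = k), p k * d s k
      = n * empMean p d c τ k := by
    rw [empMean, hN, mul_div_cancel₀ _ hn']
    refine Finset.sum_congr rfl fun s hs => ?_
    rw [(Finset.mem_filter.1 hs).2]
  rw [hsum]
  simp only [nsmul_eq_mul]
  ring

variable {Ω : Type*} [MeasurableSpace Ω] {μ : Measure Ω} [IsProbabilityMeasure μ]
  {D : ℕ → Fin K → Ω → ℝ} {m : Fin K → ℝ}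

/-- Hoeffding's inequality for the empirical mean of a price, at the end of a phase and for a
given number of pulls. -/
lemma IsProper.measureReal_deviation_le (hA : A.IsProper T p)
    (hp : ∀ k, p k ∈ Set.Icc (0 : ℝ) 1) (hD : IsIndepDemand μ T D m) {b : ℕ}
    (hb : b ≤ A.numPhases) (k : Fin K) {n : ℕ} (hn : 0 < n) {ρ : ℝ} (hρ : 0 ≤ ρ) :
    μ.real {ω | pullCount (A.run T p (fun t k => D t k ω) b).choice
          (A.run T p (fun t k => D t k ω) b).time k = n ∧
        √(ρ / n) < |empMean p (fun t k => D t k ω) (A.run T p (fun t k => D t k ω) b).choice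
          (A.run T p (fun t k => D t k ω) b).time k - p k * m k|}
      ≤ 2 * Real.exp (-(2 * ρ)) := by
  set r := √(ρ / n) with hr
  have hr2 : n * r ^ 2 = ρ := by
    rw [hr, Real.sq_sqrt (by positivity)]
    field_simp
  let X : ℝ → Ω → ℝ≥0∞ := fun θ ω => ∏ s ∈ Finset.range T, expFactor (p k) θ (p k * m k)
        (s < (A.run T p (fun t k => D t k ω) b).time ∧
          (A.run T p (fun t k => D t k ω) b).choice s = k) (D s k ω)
  have hI : ∀ s, MeasurableSet {d : ℕ → Fin K → ℝ |
      s < (A.run T p d b).time ∧ (A.run T p d b).choice s = k} := fun s =>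
    hA.measurableSet_run b fun S => s < S.time ∧ S.choice s = k
  have hX : ∀ θ, ∫⁻ ω, X θ ω ∂μ ≤ 1 := fun θ =>
    hD.lintegral_prod_expFactor_le_one (hp k) k θ hI
      (fun s d d' h => hA.offered_congr h hb k) le_rfl
  have hXm : ∀ θ, Measurable (X θ) := fun θ =>
    (Finset.measurable_fun_prod _ fun s _ => measurable_expFactor (hI s) s k).comp
      hD.measurable_table
  have hmarkov : ∀ θ, μ {ω | ENNReal.ofReal (Real.exp (2 * ρ)) ≤ X θ ω}
      ≤ ENNReal.ofReal (Real.exp (-(2 * ρ))) := by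
    intro θ
    have h := (mul_meas_ge_le_lintegral (μ := μ) (hXm θ)
      (ENNReal.ofReal (Real.exp (2 * ρ)))).trans (hX θ)
    rw [Real.exp_neg, ENNReal.ofReal_inv_of_pos (Real.exp_pos _)]
    rw [mul_comm] at h
    exact ENNReal.le_inv_iff_mul_le.2 h
  -- The choice $\theta=\pm4r$ maximizes $|\theta| r-\theta^2/8$, with value $2r^2$; times `n` this
  -- is $2\rho$. The two signs give the two tails.
  have hsub : {ω | pullCount (A.run T p (fun t k => D t k ω) b).choice
          (A.run T p (fun t k => D t k ω) b).time k = n ∧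
        r < |empMean p (fun t k => D t k ω) (A.run T p (fun t k => D t k ω) b).choice
          (A.run T p (fun t k => D t k ω) b).time k - p k * m k|}
      ⊆ {ω | ENNReal.ofReal (Real.exp (2 * ρ)) ≤ X (4 * r) ω} ∪
        {ω | ENNReal.ofReal (Real.exp (2 * ρ)) ≤ X (-(4 * r)) ω} := by
    rintro ω ⟨hN, hdev⟩
    have hr0 : 0 ≤ r := Real.sqrt_nonneg _
    have hn0 : (0 : ℝ) < n := by exact_mod_cast hn
    simp only [Set.mem_union, Set.mem_ofPred_eq]
    rcases lt_abs.1 hdev with h | h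
    · left
      refine (ENNReal.ofReal_le_ofReal (Real.exp_le_exp.2 ?_)).trans_eq
        (prod_expFactor_eq hn hN (4 * r) (p k * m k)).symm
      rw [← hr2]
      nlinarith [mul_le_mul_of_nonneg_left h.le hr0,
        mul_le_mul_of_nonneg_left (mul_le_mul_of_nonneg_left h.le hr0) hn0.le]
    · right
      refine (ENNReal.ofReal_le_ofReal (Real.exp_le_exp.2 ?_)).trans_eq
        (prod_expFactor_eq hn hN (-(4 * r)) (p k * m k)).symm
      rw [← hr2]
      nlinarith [mul_le_mul_of_nonneg_left h.le hr0,
        mul_le_mul_of_nonneg_left (mul_le_mul_of_nonneg_left h.le hr0) hn0.le]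
  have hfin := (measure_mono hsub).trans ((measure_union_le _ _).trans
    (add_le_add (hmarkov (4 * r)) (hmarkov (-(4 * r)))))
  rw [← ENNReal.ofReal_add (Real.exp_pos _).le (Real.exp_pos _).le] at hfin
  rw [two_mul (Real.exp _)]
  exact ENNReal.toReal_le_of_le_ofReal (by positivity) hfin

end PhasedAlgorithm
open scoped ENNReal

/-! ### From regret to gaps -/

/-- The gap between the best mean reward and that of price `k`. -/
noncomputable def rewardGap {K : ℕ} [NeZero K] (p m : Fin K → ℝ) (k : Fin K) : ℝ :=
  Finset.univ.sup' Finset.univ_nonempty (fun k : Fin K => p k * m k) - p k * m k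

lemma rewardGap_nonneg {K : ℕ} [NeZero K] (p m : Fin K → ℝ) (k : Fin K) : 0 ≤ rewardGap p m k :=
  sub_nonneg.2 (Finset.le_sup' (fun k : Fin K => p k * m k) (Finset.mem_univ k))

lemma exists_rewardGap_eq {K : ℕ} [NeZero K] (p m : Fin K → ℝ) :
    ∃ a, ∀ k, rewardGap p m k = p a * m a - p k * m k := by
  obtain ⟨a, -, ha⟩ := Finset.exists_mem_eq_sup' Finset.univ_nonempty (fun k : Fin K => p k * m k)
  exact ⟨a, fun k => by rw [rewardGap, ha]⟩

lemma IsIndepDemand.mean_mem_Icc {K : ℕ} {Ω : Type*} [MeasurableSpace Ω] {μ : Measure Ω}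
    [IsProbabilityMeasure μ] {T : ℕ} {D : ℕ → Fin K → Ω → ℝ} {m : Fin K → ℝ}
    (hD : IsIndepDemand μ T D m) (hT : 1 ≤ T) (k : Fin K) : m k ∈ Set.Icc (0 : ℝ) 1 := by
  rw [← hD.integral_eq 0 hT k]
  refine ⟨integral_nonneg fun ω => (hD.mem_Icc 0 k ω).1, ?_⟩
  have h : Integrable (fun ω => D 0 k ω) μ := Integrable.of_mem_Icc 0 1
    (hD.measurable 0 k).aemeasurable (Filter.Eventually.of_forall (hD.mem_Icc 0 k))
  simpa using integral_mono h (integrable_const (1 : ℝ)) (fun ω => (hD.mem_Icc 0 k ω).2)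

lemma reward_mem_Icc {x y : ℝ} (hx : x ∈ Set.Icc (0 : ℝ) 1) (hy : y ∈ Set.Icc (0 : ℝ) 1) :
    x * y ∈ Set.Icc (0 : ℝ) 1 :=
  ⟨mul_nonneg hx.1 hy.1, mul_le_one₀ hx.2 hy.1 hy.2⟩

lemma rewardGap_le_one {K : ℕ} [NeZero K] {p m : Fin K → ℝ}
    (hp : ∀ k, p k ∈ Set.Icc (0 : ℝ) 1) (hm : ∀ k, m k ∈ Set.Icc (0 : ℝ) 1) (k : Fin K) :
    rewardGap p m k ≤ 1 := by
  obtain ⟨a, ha⟩ := exists_rewardGap_eq p m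
  rw [ha]
  linarith [(reward_mem_Icc (hp a) (hm a)).2, (reward_mem_Icc (hp k) (hm k)).1]

/-- Expectation of a random variable that is bounded by a combination of indicators. -/
lemma integral_le_add_sum_mul_measureReal {Ω ι : Type*} [MeasurableSpace Ω] {μ : Measure Ω}
    [IsProbabilityMeasure μ] {f : Ω → ℝ} (hf : Integrable f μ) (c₀ : ℝ) (s : Finset ι)
    {c : ι → ℝ} (hc : ∀ i ∈ s, 0 ≤ c i) (F : ι → Set Ω)
    (h : ∀ ω, f ω ≤ c₀ + ∑ i ∈ s, c i * (F i).indicator (fun _ => (1 : ℝ)) ω) :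
    ∫ ω, f ω ∂μ ≤ c₀ + ∑ i ∈ s, c i * μ.real (F i) := by
  -- The events need not be measurable, so they are replaced by measurable hulls of the same
  -- measure.
  let G : ι → Set Ω := fun i => toMeasurable μ (F i)
  have hG : ∀ i, MeasurableSet (G i) := fun i => measurableSet_toMeasurable _ _
  have hGi : ∀ i, Integrable ((G i).indicator fun _ => (1 : ℝ)) μ := fun i =>
    (integrable_const _).indicator (hG i)
  calc ∫ ω, f ω ∂μ ≤ ∫ ω, (c₀ + ∑ i ∈ s, c i * (G i).indicator (fun _ => (1 : ℝ)) ω) ∂μ := by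
        refine integral_mono hf ((integrable_const _).add
          (integrable_finsetSum _ fun i _ => (hGi i).const_mul _)) fun ω => (h ω).trans ?_
        have hle : ∀ i, (F i).indicator (fun _ => (1 : ℝ)) ω ≤ (G i).indicator (fun _ => 1) ω :=
          fun i => Set.indicator_le_indicator_of_subset (subset_toMeasurable μ (F i))
            (fun _ => zero_le_one (α := ℝ)) ω
        exact add_le_add_right
          (Finset.sum_le_sum fun i hi => mul_le_mul_of_nonneg_left (hle i) (hc i hi)) _
    _ = c₀ + ∑ i ∈ s, c i * μ.real (F i) := by
        rw [integral_add (integrable_const _)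
          (integrable_finsetSum _ fun i _ => (hGi i).const_mul _), integral_const,
          integral_finsetSum _ fun i _ => (hGi i).const_mul _]
        simp only [integral_const_mul, integral_indicator_const _ (hG _)]
        simp [G, Measure.real, measure_toMeasurable]

namespace PhasedAlgorithm

variable {K : ℕ} [NeZero K] {A : PhasedAlgorithm K} {T : ℕ} {p : Fin K → ℝ}

lemma IsProper.measurable_of_prices (hA : A.IsProper T p) {f : (ℕ → Fin K) → (ℕ → Fin K → ℝ) → ℝ}
    (hf : ∀ i, Measurable (f i)) : Measurable fun d => f (A.prices T p d) d :=
  hA.measurable_run A.numPhases (f := fun R d => f R.choice d) fun R => hf R.choice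

variable {Ω : Type*} [MeasurableSpace Ω] {μ : Measure Ω} {D : ℕ → Fin K → Ω → ℝ} {m : Fin K → ℝ}

/-- The trivial bound: regret is at most the length of the horizon. -/
lemma regret_le_horizon (hp : ∀ k, p k ∈ Set.Icc (0 : ℝ) 1) (hm : ∀ k, m k ∈ Set.Icc (0 : ℝ) 1)
    (hD : IsIndepDemand μ T D m) (M : ℕ) :
    T * Finset.univ.sup' Finset.univ_nonempty (fun k : Fin K => p k * m k)
      - ∫ ω, revenue p T M (A.prices T p (fun t k => D t k ω)) (fun t k => D t k ω) ∂μ ≤ T := by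
  have h1 : 0 ≤ ∫ ω,
      revenue p T M (A.prices T p (fun t k => D t k ω)) (fun t k => D t k ω) ∂μ :=
    integral_nonneg fun ω => Finset.sum_nonneg fun t _ =>
      mul_nonneg (finalPrice_nonneg hp _ _ _ _) (hD.mem_Icc _ _ _).1
  have h2 : Finset.univ.sup' Finset.univ_nonempty (fun k : Fin K => p k * m k) ≤ 1 :=
    Finset.sup'_le _ _ fun k _ => (reward_mem_Icc (hp k) (hm k)).2
  nlinarith [Nat.cast_nonneg (α := ℝ) T]

variable [IsProbabilityMeasure μ]

/-- The price offered at time `t` is independent of the demand at time `t`. -/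
lemma IsProper.integral_reward (hA : A.IsProper T p) (hp : ∀ k, p k ∈ Set.Icc (0 : ℝ) 1)
    (hD : IsIndepDemand μ T D m) {t : ℕ} (ht : t < T) :
    ∫ ω, p (A.prices T p (fun t k => D t k ω) t) * D t (A.prices T p (fun t k => D t k ω) t) ω ∂μ
      = ∫ ω, p (A.prices T p (fun t k => D t k ω) t)
          * m (A.prices T p (fun t k => D t k ω) t) ∂μ := by
  classical
  -- Splitting by the offered price turns the random index into fixed ones. Each indicator depends
  -- only on demands before `t`, hence is independent of the demand at time `t`.
  let I : Fin K → (ℕ → Fin K → ℝ) → ℝ := fun k d =>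
    if t < (A.run T p d A.numPhases).time ∧ (A.run T p d A.numPhases).choice t = k then 1 else 0
  have hI : ∀ k, Measurable (I k) := fun k => Measurable.ite
    (hA.measurableSet_run _ fun S => t < S.time ∧ S.choice t = k) measurable_const measurable_const
  have hIeq : ∀ k d, I k d = if A.prices T p d t = k then 1 else 0 := by
    intro k d
    simp only [I, hA.run_numPhases_time d, ht, true_and]
    rfl
  have htab := hD.measurable_table
  have hI01 : ∀ k d, I k d ∈ Set.Icc (0 : ℝ) 1 := by
    intro k d
    simp only [I]
    split_ifs <;> simp
  have hInt : ∀ k (f : Ω → ℝ), Measurable f → (∀ ω, f ω ∈ Set.Icc (0 : ℝ) 1) →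
      Integrable (fun ω => I k (fun t k => D t k ω) * f ω) μ := fun k f hf hf1 =>
    Integrable.of_mem_Icc 0 1 (((hI k).comp htab).mul hf).aemeasurable
      (Filter.Eventually.of_forall fun ω => reward_mem_Icc (hI01 _ _) (hf1 ω))
  have hm := hD.mean_mem_Icc (by omega : 1 ≤ T)
  have h1 : ∀ (x : Fin K → ℝ) d,
      x (A.prices T p d t) = ∑ k, I k d * x k := by
    intro x d
    simp [hIeq]
  have h2 : ∀ k, ∫ ω, I k (fun t k => D t k ω) * (p k * D t k ω) ∂μ
      = ∫ ω, I k (fun t k => D t k ω) * (p k * m k) ∂μ := by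
    intro k
    have hind := hD.indepFun_past (hI k) ht (fun d d' h => by
      simp only [I, hA.offered_congr h le_rfl k])
    have hφ : Measurable fun x : Fin K → ℝ => p k * x k := by fun_prop
    have hind' := hind.comp measurable_id hφ
    have := hind'.integral_fun_mul_eq_mul_integral
      ((hI k).comp htab).aestronglyMeasurable
      ((hD.measurable t k).const_mul (p k)).aestronglyMeasurable
    simp only [Function.comp_def, id] at this
    rw [this, integral_const_mul, hD.integral_eq t ht, integral_mul_const]
  have h3 : ∀ ω, p (A.prices T p (fun t k => D t k ω) t)
        * D t (A.prices T p (fun t k => D t k ω) t) ω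
      = ∑ k, I k (fun t k => D t k ω) * (p k * D t k ω) := fun ω =>
    h1 (fun k => p k * D t k ω) _
  have h4 : ∀ ω, p (A.prices T p (fun t k => D t k ω) t)
        * m (A.prices T p (fun t k => D t k ω) t)
      = ∑ k, I k (fun t k => D t k ω) * (p k * m k) := fun ω =>
    h1 (fun k => p k * m k) _
  simp only [h3, h4]
  rw [integral_finsetSum _ fun k _ => hInt k _ ((hD.measurable t k).const_mul (p k))
      fun ω => reward_mem_Icc (hp k) (hD.mem_Icc t k ω),
    integral_finsetSum _ fun k _ => hInt k _ measurable_const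
      fun ω => reward_mem_Icc (hp k) (hm k)]
  exact Finset.sum_congr rfl fun k _ => h2 k

lemma IsProper.integrable_of_prices (hA : A.IsProper T p) (hD : IsIndepDemand μ T D m)
    {f : (ℕ → Fin K) → (ℕ → Fin K → ℝ) → ℝ} (hf : ∀ i, Measurable (f i)) (a b : ℝ)
    (hab : ∀ i ω, f i (fun t k => D t k ω) ∈ Set.Icc a b) :
    Integrable (fun ω => f (A.prices T p fun t k => D t k ω) fun t k => D t k ω) μ :=
  Integrable.of_mem_Icc a b ((hA.measurable_of_prices hf).comp hD.measurable_table).aemeasurable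
    (Filter.Eventually.of_forall fun ω => hab _ ω)

/-- Regret is at most the expected sum of the gaps of the offered prices plus the refunds. -/
lemma IsProper.regret_le_integral_add (hA : A.IsProper T p) (hp : ∀ k, p k ∈ Set.Icc (0 : ℝ) 1)
    (hD : IsIndepDemand μ T D m) (M : ℕ) {L : ℝ}
    (hL : ∀ d : ℕ → Fin K → ℝ, (∀ t k, d t k ∈ Set.Icc (0 : ℝ) 1) →
      ∑ t ∈ Finset.range T, p (A.prices T p d t) * d t (A.prices T p d t)
        - revenue p T M (A.prices T p d) d ≤ L) :
    T * Finset.univ.sup' Finset.univ_nonempty (fun k : Fin K => p k * m k)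
      - ∫ ω, revenue p T M (A.prices T p (fun t k => D t k ω)) (fun t k => D t k ω) ∂μ
    ≤ ∫ ω, ∑ t ∈ Finset.range T, rewardGap p m (A.prices T p (fun t k => D t k ω) t) ∂μ + L := by
  rcases Nat.eq_zero_or_pos T with rfl | hT
  · have := hL (fun _ _ => 0) (by simp)
    simpa [revenue] using this
  have hm := hD.mean_mem_Icc hT
  have hrev : Integrable
      (fun ω => revenue p T M (A.prices T p (fun t k => D t k ω)) (fun t k => D t k ω)) μ := by
    refine hA.integrable_of_prices hD (f := fun i d => revenue p T M i d)
      (fun i => by unfold revenue; fun_prop) 0 T fun i ω => ⟨?_, ?_⟩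
    · exact Finset.sum_nonneg fun t _ =>
        mul_nonneg (finalPrice_nonneg hp _ _ _ _) (hD.mem_Icc _ _ _).1
    · refine (Finset.sum_le_sum fun t _ => mul_le_one₀ (finalPrice_le_one hp T M i t)
        (hD.mem_Icc _ _ _).1 (hD.mem_Icc _ _ _).2).trans ?_
      simp
  have hrwd : ∀ t, Integrable (fun ω => p (A.prices T p (fun t k => D t k ω) t)
      * D t (A.prices T p (fun t k => D t k ω) t) ω) μ := fun t =>
    hA.integrable_of_prices hD (f := fun i d => p (i t) * d t (i t)) (fun i => by fun_prop) 0 1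
      fun i ω => reward_mem_Icc (hp _) (hD.mem_Icc _ _ _)
  have hmean : ∀ t, Integrable (fun ω => p (A.prices T p (fun t k => D t k ω) t)
      * m (A.prices T p (fun t k => D t k ω) t)) μ := fun t =>
    hA.integrable_of_prices hD (f := fun i _ => p (i t) * m (i t)) (fun i => by fun_prop) 0 1
      fun i ω => reward_mem_Icc (hp _) (hm _)
  have h1 : ∫ ω, ∑ t ∈ Finset.range T, p (A.prices T p (fun t k => D t k ω) t)
        * D t (A.prices T p (fun t k => D t k ω) t) ω ∂μ
      - ∫ ω, revenue p T M (A.prices T p (fun t k => D t k ω)) (fun t k => D t k ω) ∂μ ≤ L := by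
    rw [← integral_sub (integrable_finsetSum _ fun t _ => hrwd t) hrev]
    refine (integral_mono ((integrable_finsetSum _ fun t _ => hrwd t).sub hrev)
      (integrable_const L) fun ω => hL _ fun t k => hD.mem_Icc t k ω).trans ?_
    simp
  have h2 : ∫ ω, ∑ t ∈ Finset.range T, rewardGap p m (A.prices T p (fun t k => D t k ω) t) ∂μ
      = T * Finset.univ.sup' Finset.univ_nonempty (fun k : Fin K => p k * m k)
        - ∫ ω, ∑ t ∈ Finset.range T, p (A.prices T p (fun t k => D t k ω) t)
          * D t (A.prices T p (fun t k => D t k ω) t) ω ∂μ := by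
    simp only [rewardGap, Finset.sum_sub_distrib]
    rw [integral_sub (integrable_const _) (integrable_finsetSum _ fun t _ => hmean t),
      integral_finsetSum _ fun t _ => hmean t, integral_finsetSum _ fun t _ => hrwd t]
    rw [Finset.sum_congr rfl fun t ht => hA.integral_reward hp hD (Finset.mem_range.1 ht)]
    simp
  rw [h2]
  linarith

/-- Regret bound from a pathwise bound of the gaps in terms of unlikely events. -/
lemma IsProper.regret_le_of_forall_le {ι : Type*} (hA : A.IsProper T p)
    (hp : ∀ k, p k ∈ Set.Icc (0 : ℝ) 1) (hD : IsIndepDemand μ T D m) (M : ℕ) {L : ℝ}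
    (hL : ∀ d : ℕ → Fin K → ℝ, (∀ t k, d t k ∈ Set.Icc (0 : ℝ) 1) →
      ∑ t ∈ Finset.range T, p (A.prices T p d t) * d t (A.prices T p d t)
        - revenue p T M (A.prices T p d) d ≤ L)
    (c₀ : ℝ) (s : Finset ι) {c : ι → ℝ} (hc : ∀ i ∈ s, 0 ≤ c i) (F : ι → Set Ω)
    (h : ∀ ω, ∑ t ∈ Finset.range T, rewardGap p m (A.prices T p (fun t k => D t k ω) t)
      ≤ c₀ + ∑ i ∈ s, c i * (F i).indicator (fun _ => (1 : ℝ)) ω) :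
    T * Finset.univ.sup' Finset.univ_nonempty (fun k : Fin K => p k * m k)
      - ∫ ω, revenue p T M (A.prices T p (fun t k => D t k ω)) (fun t k => D t k ω) ∂μ
    ≤ c₀ + ∑ i ∈ s, c i * μ.real (F i) + L := by
  refine (hA.regret_le_integral_add hp hD M hL).trans (add_le_add_left ?_ _)
  refine integral_le_add_sum_mul_measureReal ?_ c₀ s hc F h
  refine integrable_finsetSum _ fun t ht => ?_
  have hm := hD.mean_mem_Icc (by rw [Finset.mem_range] at ht; omega)
  exact hA.integrable_of_prices hD (f := fun i _ => rewardGap p m (i t)) (fun i => by fun_prop) 0 1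
    fun i ω => ⟨rewardGap_nonneg _ _ _, rewardGap_le_one hp hm _⟩

end PhasedAlgorithm

/-! ### Truncated demand -/

/-- Demand truncated to `[0,1]`, and to the horizon. -/
noncomputable def truncDemand {K : ℕ} {Ω : Type*} (T : ℕ) (D : ℕ → Fin K → Ω → ℝ) :
    ℕ → Fin K → Ω → ℝ :=
  fun t k ω => if t < T then max 0 (min 1 (D t k ω)) else 0

section

variable {K : ℕ} {Ω : Type*} [MeasurableSpace Ω] {μ : Measure Ω} {T : ℕ} {D : ℕ → Fin K → Ω → ℝ}

lemma IsIIDDemand.truncDemand_ae_eq (hD : IsIIDDemand μ T D) :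
    ∀ᵐ ω ∂μ, ∀ t < T, ∀ k, truncDemand T D t k ω = D t k ω := by
  rw [ae_all_iff]; intro t
  rw [ae_all_iff]; intro ht
  rw [ae_all_iff]; intro k
  filter_upwards [hD.mem_Icc t ht k] with ω hω
  rw [truncDemand, if_pos ht, min_eq_right hω.2, max_eq_right hω.1]

/-- The pathwise arguments need demand that is bounded everywhere and measurable at all times.
Truncation provides this without changing the means, since it alters the demand within the horizon
only on a null set. -/
lemma IsIIDDemand.isIndepDemand_truncDemand (hD : IsIIDDemand μ T D) (hT : 1 ≤ T) :
    IsIndepDemand μ T (truncDemand T D) (fun k => ∫ ω, D 0 k ω ∂μ) where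
  measurable t k := by
    unfold truncDemand
    split_ifs with ht
    · have := hD.measurable t ht k
      fun_prop
    · exact measurable_const
  mem_Icc t k ω := by
    unfold truncDemand
    split_ifs
    · exact ⟨le_max_left _ _, max_le zero_le_one (min_le_left _ _)⟩
    · simp
  indep := by
    have h := hD.indep.comp (fun _ (x : Fin K → ℝ) k => max 0 (min 1 (x k)))
      (fun _ => by fun_prop)
    convert h using 2 with t
    funext ω k
    simp [truncDemand, t.2]
  integral_eq t ht k := by
    rw [← (hD.identDistrib t ht 0 hT k).integral_eq]
    refine integral_congr_ae ?_
    filter_upwards [hD.truncDemand_ae_eq] with ω hω using hω t ht k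

/-- A proper run reads only demands before the horizon, and these agree almost surely with the
truncated ones. -/
lemma IsIIDDemand.regret_eq [NeZero K] (hD : IsIIDDemand μ T D) (M : ℕ)
    {p : Fin K → ℝ} {A : PhasedAlgorithm K} (hA : A.IsProper T p) :
    regret μ T M p D A =
      T * Finset.univ.sup' Finset.univ_nonempty (fun k : Fin K => p k * ∫ ω, D 0 k ω ∂μ)
        - ∫ ω, revenue p T M (A.prices T p (fun t k => truncDemand T D t k ω))
          (fun t k => truncDemand T D t k ω) ∂μ := by
  rw [regret]
  congr 1
  refine integral_congr_ae ?_
  filter_upwards [hD.truncDemand_ae_eq] with ω hω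
  have h1 : A.prices T p (fun t k => truncDemand T D t k ω) = A.prices T p (fun t k => D t k ω) := by
    unfold PhasedAlgorithm.prices
    rw [hA.run_congr_horizon (fun t ht => funext fun k => hω t ht k) le_rfl]
  rw [h1]
  refine Finset.sum_congr rfl fun t ht => ?_
  simp only [hω t (Finset.mem_range.1 ht)]

end

/-! ### Confidence tests -/

lemma measurableSet_finset_eq {α β : Type*} [MeasurableSpace α] [Finite β] {g : α → Finset β}
    (hg : ∀ i, MeasurableSet {x | i ∈ g x}) (Q : Finset β) : MeasurableSet {x | g x = Q} := by
  have : {x | g x = Q} = ⋂ i, {x | i ∈ g x ↔ i ∈ Q} := by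
    ext x
    simp [Finset.ext_iff]
  rw [this]
  refine MeasurableSet.iInter fun i => ?_
  by_cases h : i ∈ Q
  · simpa [h] using hg i
  · simp only [h, iff_false]
    exact (hg i).compl

section

variable {K : ℕ} {ρ : ℝ} {P : Finset (Fin K)} {N : Fin K → ℕ} {lam : Fin K → ℝ}

lemma mem_confidenceTest {i : Fin K} : i ∈ confidenceTest ρ P N lam ↔
    i ∈ P ∧ ∀ j ∈ P, N i = 0 ∨ N j = 0 ∨ lam j - √(ρ / N j) ≤ lam i + √(ρ / N i) := by
  classical
  simp [confidenceTest]

lemma confidenceTest_subset : confidenceTest ρ P N lam ⊆ P :=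
  fun _ hi => (mem_confidenceTest.1 hi).1

/-- The price with the largest upper confidence value passes. The convention $\rho/0=0$ is harmless
here: radii only have to be nonnegative. -/
lemma confidenceTest_nonempty (hP : P.Nonempty) : (confidenceTest ρ P N lam).Nonempty := by
  obtain ⟨i, hi, hmax⟩ := P.exists_max_image (fun i => lam i + √(ρ / N i)) hP
  refine ⟨i, mem_confidenceTest.2 ⟨hi, fun j hj => Or.inr (Or.inr ?_)⟩⟩
  linarith [hmax j hj, Real.sqrt_nonneg (ρ / N j)]

lemma measurableSet_confidenceTest (ρ : ℝ) (P : Finset (Fin K)) (N : Fin K → ℕ)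
    (Q : Finset (Fin K)) : MeasurableSet {lam | confidenceTest ρ P N lam = Q} := by
  refine measurableSet_finset_eq (fun i => ?_) Q
  simp only [mem_confidenceTest]
  refine (MeasurableSet.const _).inter ?_
  have : {lam : Fin K → ℝ | ∀ j ∈ P, N i = 0 ∨ N j = 0 ∨
        lam j - √(ρ / N j) ≤ lam i + √(ρ / N i)}
      = ⋂ j ∈ P, {lam | N i = 0 ∨ N j = 0 ∨ lam j - √(ρ / N j) ≤ lam i + √(ρ / N i)} := by
    ext; simp
  change MeasurableSet {lam : Fin K → ℝ | ∀ j ∈ P, N i = 0 ∨ N j = 0 ∨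
        lam j - √(ρ / N j) ≤ lam i + √(ρ / N i)}
  rw [this]
  refine Finset.measurableSet_biInter _ fun j _ => ?_
  exact (MeasurableSet.const _).union ((MeasurableSet.const _).union
    (measurableSet_le ((measurable_pi_apply j).sub_const _)
      ((measurable_pi_apply i).add_const _)))

variable {v : Fin K → ℝ} {a : Fin K}

/-- The best price passes the test if all empirical means are within the radius. -/
lemma best_mem_confidenceTest (ha : a ∈ P) (hbest : ∀ k, v k ≤ v a)
    (h : ∀ k ∈ P, N k = 0 ∨ |lam k - v k| ≤ √(ρ / N k)) : a ∈ confidenceTest ρ P N lam := by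
  refine mem_confidenceTest.2 ⟨ha, fun j hj => ?_⟩
  rcases h a ha with h1 | h1
  · exact Or.inl h1
  rcases h j hj with h2 | h2
  · exact Or.inr (Or.inl h2)
  · refine Or.inr (Or.inr ?_)
    linarith [hbest j, (abs_le.1 h1).1, (abs_le.1 h2).2]

/-- A price that passes the test is almost as good as the best price. -/
lemma sub_le_of_mem_confidenceTest (ha : a ∈ P)
    (h : ∀ k ∈ P, N k = 0 ∨ |lam k - v k| ≤ √(ρ / N k)) {k : Fin K}
    (hk : k ∈ confidenceTest ρ P N lam) (hNa : N a ≠ 0) (hNk : N k ≠ 0) :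
    v a - v k ≤ 2 * √(ρ / N a) + 2 * √(ρ / N k) := by
  obtain ⟨hkP, hk⟩ := mem_confidenceTest.1 hk
  have h0 := ((hk a ha).resolve_left hNk).resolve_left hNa
  have h1 := (h a ha).resolve_left hNa
  have h2 := (h k hkP).resolve_left hNk
  linarith [(abs_le.1 h1).1, (abs_le.1 h2).2]

end

/-! ### The sub-algorithms are proper -/

section

variable {K : ℕ} [NeZero K] {T : ℕ}

lemma improvedUCB_isProper (p : Fin K → ℝ) : (improvedUCB K T).IsProper T p where
  numPhases_pos := Nat.succ_pos _
  time_le_succ d b _ := by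
    rw [PhasedAlgorithm.run_succ_time]
    have := (improvedUCB K T).run_time_le T p d b
    split_ifs
    · exact this
    · exact le_min (Nat.le_add_right _ _) this
  test_nonempty _ _ _ _ hP := confidenceTest_nonempty hP
  measurableSet_test _ _ _ _ := measurableSet_confidenceTest _ _ _ _

/-- The grid of the batched elimination algorithm before rounding. -/
noncomputable def batchGrid (T b : ℕ) : ℝ :=
  √(Real.exp 1 * T) ^ ((2 : ℝ) - (2 : ℝ) ^ ((1 : ℝ) - b))

lemma one_le_sqrt_exp_mul (hT : 1 ≤ T) : 1 ≤ √(Real.exp 1 * T) := by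
  rw [Real.one_le_sqrt]
  have h1 : (1 : ℝ) ≤ T := by exact_mod_cast hT
  have h2 : (1 : ℝ) ≤ Real.exp 1 := Real.one_le_exp zero_le_one
  nlinarith

lemma batchGrid_mono (hT : 1 ≤ T) : Monotone (batchGrid T) := by
  intro b c hbc
  refine Real.rpow_le_rpow_of_exponent_le (one_le_sqrt_exp_mul hT) ?_
  have : (b : ℝ) ≤ c := by exact_mod_cast hbc
  have := Real.rpow_le_rpow_of_exponent_le (x := 2) one_le_two
    (by linarith : (1 : ℝ) - c ≤ 1 - b)
  linarith

lemma batchedElimination_time (p : Fin K → ℝ) (d : ℕ → Fin K → ℝ) {b : ℕ}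
    (hb : b + 1 < (batchedElimination K T).numPhases) :
    ((batchedElimination K T).run T p d (b + 1)).time = min ⌈batchGrid T (b + 1)⌉₊ T := by
  rw [PhasedAlgorithm.run_succ_time, if_neg hb.ne]
  rfl

lemma batchedElimination_isProper (hT : 1 ≤ T) (p : Fin K → ℝ) :
    (batchedElimination K T).IsProper T p where
  numPhases_pos := lt_of_lt_of_le one_pos (le_max_left _ _)
  time_le_succ d b hb := by
    cases b with
    | zero => exact Nat.zero_le _
    | succ b =>
      rw [batchedElimination_time p d hb]
      by_cases h : b + 1 + 1 = (batchedElimination K T).numPhases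
      · rw [PhasedAlgorithm.run_succ_time, if_pos h]
        exact min_le_right _ _
      · rw [batchedElimination_time p d (by omega)]
        exact min_le_min (Nat.ceil_mono (batchGrid_mono hT (by omega))) le_rfl
  test_nonempty _ _ _ _ hP := confidenceTest_nonempty hP
  measurableSet_test _ _ _ _ := measurableSet_confidenceTest _ _ _ _

lemma exploreThenCommit_isProper (tie : Finset (Fin K) → Fin K) (p : Fin K → ℝ) :
    (exploreThenCommit K T tie).IsProper T p where
  numPhases_pos := two_pos
  time_le_succ d b hb := by
    have hb2 : b < 2 := hb
    interval_cases b
    · exact Nat.zero_le _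
    · exact PhasedAlgorithm.run_time_le _ _ _ _ _
  test_nonempty _ _ _ _ _ := Finset.singleton_nonempty _
  measurableSet_test _ _ _ Q := by
    classical
    let g : (Fin K → ℝ) → Finset (Fin K) := fun lam =>
      Finset.univ.filter fun i => ∀ j, lam j ≤ lam i
    have hg : ∀ S, MeasurableSet {lam | g lam = S} := by
      refine measurableSet_finset_eq fun i => ?_
      have : {lam | i ∈ g lam} = ⋂ j, {lam : Fin K → ℝ | lam j ≤ lam i} := by
        ext; simp [g]
      exact this ▸ MeasurableSet.iInter fun j => measurableSet_le (by fun_prop) (by fun_prop)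
    -- The tie rule acts on the finite type of argmax sets, so it needs no measurability of its own.
    have : {lam | ({tie (g lam)} : Finset (Fin K)) = Q}
        = ⋃ S ∈ {S : Finset (Fin K) | {tie S} = Q}, {lam | g lam = S} := by
      ext; simp
    have hQ : MeasurableSet {lam | ({tie (g lam)} : Finset (Fin K)) = Q} :=
      this ▸ MeasurableSet.biUnion (Set.to_countable _) fun S _ => hg S
    simp only [exploreThenCommit]
    convert hQ using 7

end

/-! ### Deviation events and nested plausible sets. -/

namespace PhasedAlgorithm

section

variable {K : ℕ} [NeZero K] {A : PhasedAlgorithm K} {T : ℕ} {p : Fin K → ℝ}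

/-- At the end of phase `b`, the price `k` has been offered `n` times, and its empirical mean is
off by more than `√(ρ / n)`. -/
def Deviates (A : PhasedAlgorithm K) (T : ℕ) (p m : Fin K → ℝ) (b : ℕ) (ρ : ℝ) (n : ℕ)
    (k : Fin K) (d : ℕ → Fin K → ℝ) : Prop :=
  pullCount (A.run T p d b).choice (A.run T p d b).time k = n ∧
    √(ρ / n) < |empMean p d (A.run T p d b).choice (A.run T p d b).time k - p k * m k|

lemma IsProper.measureReal_exists_deviates_le {Ω : Type*} [MeasurableSpace Ω] {μ : Measure Ω}
    [IsProbabilityMeasure μ] {D : ℕ → Fin K → Ω → ℝ} {m : Fin K → ℝ} (hA : A.IsProper T p)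
    (hp : ∀ k, p k ∈ Set.Icc (0 : ℝ) 1) (hD : IsIndepDemand μ T D m) {b : ℕ}
    (hb : b ≤ A.numPhases) {n : ℕ} (hn : 0 < n) {ρ : ℝ} (hρ : 0 ≤ ρ) :
    μ.real {ω | ∃ k, A.Deviates T p m b ρ n k fun t k => D t k ω}
      ≤ 2 * K * Real.exp (-(2 * ρ)) := by
  rw [Set.ofPred_exists]
  refine (measureReal_iUnion_fintype_le _).trans ?_
  refine (Finset.sum_le_sum fun k _ => hA.measureReal_deviation_le hp hD hb k hn hρ).trans ?_
  simp
  linarith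

/-- This allows all steps after phase `b` to be charged to the survivors of phase `b`, whatever
later tests do. -/
lemma IsProper.prices_mem_of_nested (hA : A.IsProper T p) (d : ℕ → Fin K → ℝ) {b : ℕ}
    (hnest : ∀ c, b ≤ c → c < A.numPhases →
      (A.run T p d c).plausible ⊆ (A.run T p d b).plausible)
    {c : ℕ} (hbc : b ≤ c) (hc : c ≤ A.numPhases) {t : ℕ} (ht : (A.run T p d b).time ≤ t)
    (htc : t < (A.run T p d c).time) : A.prices T p d t ∈ (A.run T p d b).plausible := by
  induction c, hbc using Nat.le_induction with
  | base => omega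
  | succ c hbc ih =>
    by_cases h : t < (A.run T p d c).time
    · exact ih (by omega) h
    · exact hnest c hbc (by omega) (hA.prices_mem_plausible d (by omega) (not_lt.1 h) htc)

lemma plausible_subset_of_test_subset (hsub : ∀ b P N lam, A.test b P N lam ⊆ P)
    (d : ℕ → Fin K → ℝ) {b c : ℕ} (hbc : b ≤ c) :
    (A.run T p d c).plausible ⊆ (A.run T p d b).plausible := by
  induction c, hbc using Nat.le_induction with
  | base => rfl
  | succ c _ ih => rw [run_succ_plausible]; exact (hsub _ _ _ _).trans ih

end

end PhasedAlgorithm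

/-! ### The schedule of improved UCB -/

section

variable {T b : ℕ}

/-- The number of phases of improved UCB before the last one. -/
noncomputable def ucbPhases (T : ℕ) : ℕ := ⌊Real.logb 2 (T / Real.exp 1) / 2⌋₊

lemma two_pow_le_of_le_ucbPhases (hT : 1 ≤ T) (hb : b ≠ 0) (h : b ≤ ucbPhases T) :
    Real.exp 1 * (2 : ℝ) ^ (2 * b) ≤ T := by
  have hT0 : (0 : ℝ) < T := by exact_mod_cast hT
  rw [ucbPhases, Nat.le_floor_iff' hb, le_div_iff₀ two_pos,
    Real.le_logb_iff_rpow_le one_lt_two (by positivity), le_div_iff₀ (Real.exp_pos _)] at h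
  have : (2 : ℝ) ^ ((b : ℝ) * 2) = 2 ^ (2 * b) := by
    rw [← Real.rpow_natCast]; push_cast; ring_nf
  rw [this] at h
  linarith

lemma one_le_log_of_le_ucbPhases (hT : 1 ≤ T) (hb : b ≠ 0) (h : b ≤ ucbPhases T) :
    1 ≤ Real.log (T / (2 : ℝ) ^ (2 * b)) := by
  have hT0 : (0 : ℝ) < T := by exact_mod_cast hT
  rw [Real.le_log_iff_exp_le (by positivity), le_div_iff₀ (by positivity)]
  exact two_pow_le_of_le_ucbPhases hT hb h

lemma le_ucbPulls (hb : b ≠ 0) :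
    (2 : ℝ) ^ (2 * b + 1) * Real.log (T / (2 : ℝ) ^ (2 * b)) ≤ ucbPulls T b := by
  rw [ucbPulls, if_neg hb]
  exact Nat.le_ceil _

lemma ucbPulls_pos (hT : 1 ≤ T) (hb : b ≠ 0) (h : b ≤ ucbPhases T) : 0 < ucbPulls T b := by
  have h1 := one_le_log_of_le_ucbPhases hT hb h
  have h2 := le_ucbPulls (T := T) hb
  have h3 : (0 : ℝ) < (2 : ℝ) ^ (2 * b + 1) * Real.log (T / (2 : ℝ) ^ (2 * b)) :=
    mul_pos (by positivity) (by linarith)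
  exact_mod_cast h3.trans_le h2

lemma ucbPulls_le (hT : 1 ≤ T) (b : ℕ) :
    (ucbPulls T b : ℝ) ≤ 2 ^ (2 * b + 1) * (1 + Real.log T) := by
  have hT1 : (1 : ℝ) ≤ T := by exact_mod_cast hT
  have hlogT := Real.log_nonneg hT1
  have hpow : (1 : ℝ) ≤ 2 ^ (2 * b + 1) := one_le_pow₀ one_le_two
  rcases eq_or_ne b 0 with rfl | hb
  · simp only [ucbPulls, if_true, Nat.cast_zero]
    positivity
  rw [ucbPulls, if_neg hb]
  have hlog : Real.log (T / (2 : ℝ) ^ (2 * b)) ≤ Real.log T := by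
    apply Real.log_le_log (by positivity)
    exact div_le_self (by linarith) (one_le_pow₀ one_le_two)
  have hx : (2 : ℝ) ^ (2 * b + 1) * Real.log (T / (2 : ℝ) ^ (2 * b))
      ≤ 2 ^ (2 * b + 1) * Real.log T := by gcongr
  refine (Nat.cast_le.2 (Nat.ceil_mono hx)).trans ?_
  refine (Nat.ceil_lt_add_one (by positivity)).le.trans ?_
  linarith

/-- The power of two grows by 4 while the logarithm drops by $2\log2<3$; as the smaller logarithm is
at least 1, the product does not decrease. -/
lemma ucbPulls_le_succ (hT : 1 ≤ T) (h : b + 1 ≤ ucbPhases T) :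
    ucbPulls T b ≤ ucbPulls T (b + 1) := by
  rcases eq_or_ne b 0 with rfl | hb
  · simp [ucbPulls]
  rw [ucbPulls, ucbPulls, if_neg hb, if_neg (Nat.succ_ne_zero b)]
  apply Nat.ceil_mono
  have hT0 : (0 : ℝ) < T := by exact_mod_cast hT
  have h1 := one_le_log_of_le_ucbPhases hT (Nat.succ_ne_zero b) h
  have h2 : Real.log (T / (2 : ℝ) ^ (2 * b))
      = Real.log (T / (2 : ℝ) ^ (2 * (b + 1))) + 2 * Real.log 2 := by
    rw [Real.log_div (by positivity) (by positivity), Real.log_div (by positivity) (by positivity),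
      Real.log_pow, Real.log_pow]
    push_cast
    ring
  have h3 := Real.log_two_lt_d9
  rw [h2, show (2 : ℝ) ^ (2 * (b + 1) + 1) = 2 ^ (2 * b + 1) * 4 by ring, mul_assoc]
  gcongr
  linarith

/-- The pull numbers are tuned to this: four such radii make the gap of a survivor at most
$2\cdot2^{-b}$. -/
lemma sqrt_div_ucbPulls_le (hT : 1 ≤ T) (hb : b ≠ 0) (h : b ≤ ucbPhases T) :
    √(Real.log (T / (2 : ℝ) ^ (2 * b)) / 2 / ucbPulls T b) ≤ (1 / 2) ^ b / 2 := by
  have h1 := one_le_log_of_le_ucbPhases hT hb h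
  have h2 := le_ucbPulls (T := T) hb
  have h3 : (0 : ℝ) < ucbPulls T b := by exact_mod_cast ucbPulls_pos hT hb h
  rw [Real.sqrt_le_left (by positivity), div_le_iff₀ h3]
  calc Real.log (T / (2 : ℝ) ^ (2 * b)) / 2
      = ((1 / 2) ^ b / 2) ^ 2 * (2 ^ (2 * b + 1) * Real.log (T / (2 : ℝ) ^ (2 * b))) := by
        generalize Real.log (T / (2 : ℝ) ^ (2 * b)) = x
        rw [one_div, inv_pow, show (2 : ℝ) ^ (2 * b + 1) = (2 ^ b) ^ 2 * 2 by ring]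
        field_simp
    _ ≤ _ := by gcongr

lemma exp_neg_log_div_two (hT : 1 ≤ T) :
    Real.exp (-(2 * (Real.log (T / (2 : ℝ) ^ (2 * b)) / 2))) = 2 ^ (2 * b) / T := by
  have hT0 : (0 : ℝ) < T := by exact_mod_cast hT
  rw [mul_div_cancel₀ _ two_ne_zero, Real.exp_neg, Real.exp_log (by positivity), inv_div]

lemma ucbPhases_add_one_le (hT : 1 ≤ T) : (ucbPhases T : ℝ) + 1 ≤ 1 + Real.log T := by
  have hT1 : (1 : ℝ) ≤ T := by exact_mod_cast hT
  have hlogT := Real.log_nonneg hT1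
  rcases Nat.eq_zero_or_pos (ucbPhases T) with h | h
  · rw [h]; simp [hlogT]
  · have h1 := two_pow_le_of_le_ucbPhases hT h.ne' le_rfl
    have h2 : Real.log (2 ^ (2 * ucbPhases T)) ≤ Real.log T := by
      refine Real.log_le_log (by positivity) (le_trans ?_ h1)
      exact le_mul_of_one_le_left (by positivity) (Real.one_le_exp zero_le_one)
    rw [Real.log_pow] at h2
    push_cast at h2
    have h3 := Real.log_two_gt_d9
    nlinarith [Nat.cast_nonneg (α := ℝ) (ucbPhases T)]

/-- The phase at which the resolution of improved UCB reaches `√(K / T)`. -/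
lemma exists_cutoff_phase {K : ℕ} (hK : 1 ≤ K) (hKT : K ≤ T) :
    ∃ b ≤ ucbPhases T, (K : ℝ) * 2 ^ b ≤ √((K : ℝ) * T) ∧
      T * (1 / 2 : ℝ) ^ b ≤ 4 * √((K : ℝ) * T) := by
  have hK1 : (1 : ℝ) ≤ K := by exact_mod_cast hK
  have hKT1 : (K : ℝ) ≤ T := by exact_mod_cast hKT
  have hT1 : (1 : ℝ) ≤ T := hK1.trans hKT1
  have he := Real.exp_pos 1
  -- With $b=\lfloor\log_4 x\rfloor$ (or 0 if that is negative), $x\le4^{b+1}$, and $4^b\le x$ if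
  -- $b\ne0$. Dividing by `K` moves the resolution $2^{-b}$ to about $\sqrt{K/T}$.
  set x : ℝ := T / Real.exp 1 / K with hx
  have hx0 : 0 < x := by positivity
  set b := ⌊Real.logb 2 x / 2⌋₊ with hb
  refine ⟨b, ?_, ?_, ?_⟩
  · refine Nat.floor_mono (div_le_div_of_nonneg_right ?_ two_pos.le)
    exact Real.logb_le_logb_of_le one_lt_two hx0 (div_le_self (by positivity) hK1)
  · apply Real.le_sqrt_of_sq_le
    rcases eq_or_ne b 0 with h0 | h0
    -- For `b = 0` the claim is $K^2\le KT$, which is where $K\le T$ enters.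
    · rw [h0]; nlinarith
    · have h1 : b ≤ ⌊Real.logb 2 x / 2⌋₊ := le_rfl
      rw [Nat.le_floor_iff' h0, le_div_iff₀ two_pos,
        Real.le_logb_iff_rpow_le one_lt_two hx0, hx, div_div, le_div_iff₀ (by positivity)] at h1
      have h2 : (2 : ℝ) ^ ((b : ℝ) * 2) = (2 ^ b) ^ 2 := by
        rw [← pow_mul, ← Real.rpow_natCast]; push_cast; ring_nf
      rw [h2] at h1
      have h3 : (1 : ℝ) ≤ Real.exp 1 := Real.one_le_exp zero_le_one
      have h4 : (2 ^ b : ℝ) ^ 2 * K ≤ T := by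
        refine le_trans ?_ h1
        gcongr
        exact le_mul_of_one_le_left (by positivity) h3
      nlinarith
  · have h1 := (Nat.lt_floor_add_one (Real.logb 2 x / 2)).le
    rw [← hb, div_le_iff₀ two_pos, Real.logb_le_iff_le_rpow one_lt_two hx0] at h1
    have h2 : (2 : ℝ) ^ (((b : ℝ) + 1) * 2) = 4 * (2 ^ b) ^ 2 := by
      rw [← pow_mul, ← Real.rpow_natCast 2 (b * 2), show ((b : ℝ) + 1) * 2 = 2 + (b * 2 : ℕ) by
        push_cast; ring, Real.rpow_add two_pos]
      norm_num
    rw [h2, hx, div_div, div_le_iff₀ (by positivity)] at h1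
    have h3 : √((16 : ℝ) * (K * T)) = 4 * √((K : ℝ) * T) := by
      rw [Real.sqrt_mul (by norm_num), show (16 : ℝ) = 4 ^ 2 by norm_num,
        Real.sqrt_sq (by norm_num)]
    rw [← h3]
    apply Real.le_sqrt_of_sq_le
    -- The constant is $4e$ rounded up to 16.
    have h4 : (T : ℝ) ≤ 16 * (2 ^ b) ^ 2 * K := by
      refine h1.trans ?_
      have := Real.exp_one_lt_d9
      have h5 : (0 : ℝ) ≤ (2 ^ b) ^ 2 * K := by positivity
      nlinarith
    rw [one_div, inv_pow, mul_pow, inv_pow, ← div_eq_mul_inv, div_le_iff₀ (by positivity)]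
    nlinarith

end

/-! ### Regret of improved UCB -/

section

variable {K : ℕ} [NeZero K] {T : ℕ} {p m : Fin K → ℝ}

/-- Some price has an empirical mean outside of the confidence radius at the end of phase `b` of
improved UCB. -/
def UCBFails (T : ℕ) (p m : Fin K → ℝ) (b : ℕ) (d : ℕ → Fin K → ℝ) : Prop :=
  ∃ k, (improvedUCB K T).Deviates T p m b (Real.log (T / (2 : ℝ) ^ (2 * b)) / 2)
    (ucbPulls T b) k d

lemma improvedUCB_time_succ (d : ℕ → Fin K → ℝ) {b : ℕ} (hb : b + 1 ≤ ucbPhases T) :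
    ((improvedUCB K T).run T p d (b + 1)).time
      = min (((improvedUCB K T).run T p d b).time + (ucbPulls T (b + 1) - ucbPulls T b)
        * ((improvedUCB K T).run T p d b).plausible.card) T := by
  rw [PhasedAlgorithm.run_succ_time, if_neg]
  · rfl
  · have : (improvedUCB K T).numPhases = ucbPhases T + 1 := rfl
    omega

/-- While no phase fails, the surviving prices have been offered equally often and are good. -/
lemma improvedUCB_invariant (hT : 1 ≤ T) (hgap : ∀ k, rewardGap p m k ≤ 1) {a : Fin K}
    (ha : ∀ k, rewardGap p m k = p a * m a - p k * m k) {d : ℕ → Fin K → ℝ} {b : ℕ}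
    (hb : b ≤ ucbPhases T) (hok : ∀ c < b, ¬ UCBFails T p m (c + 1) d) :
    ((improvedUCB K T).run T p d b).time = T ∨
      (∀ k ∈ ((improvedUCB K T).run T p d b).plausible,
        pullCount ((improvedUCB K T).run T p d b).choice
          ((improvedUCB K T).run T p d b).time k = ucbPulls T b) ∧
      a ∈ ((improvedUCB K T).run T p d b).plausible ∧
      ∀ k ∈ ((improvedUCB K T).run T p d b).plausible, rewardGap p m k ≤ 2 * (1 / 2) ^ b := by
  have hA := improvedUCB_isProper (K := K) (T := T) p
  induction b with
  | zero =>
    right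
    refine ⟨fun k _ => by simp [pullCount, PhasedAlgorithm.run_zero_time, ucbPulls],
      Finset.mem_univ a, fun k _ => ?_⟩
    have := hgap k
    norm_num
    linarith
  | succ b ih =>
    by_cases hfull : ((improvedUCB K T).run T p d (b + 1)).time = T
    · exact Or.inl hfull
    right
    have hlt : b < (improvedUCB K T).numPhases := by
      have : (improvedUCB K T).numPhases = ucbPhases T + 1 := rfl
      omega
    have hle := hA.time_le_succ d b hlt
    have hleT := (improvedUCB K T).run_time_le T p d (b + 1)
    obtain ⟨hN, haP, -⟩ := (ih (by omega) fun c hc => hok c (by omega)).resolve_left (by omega)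
    have htime := improvedUCB_time_succ (p := p) d hb
    -- The horizon is not reached, so the phase is not cut and its length is an exact multiple of
    -- the number of survivors.
    have hphase : ((improvedUCB K T).run T p d (b + 1)).time
        - ((improvedUCB K T).run T p d b).time
        = ((improvedUCB K T).run T p d b).plausible.card
          * (ucbPulls T (b + 1) - ucbPulls T b) := by
      rw [mul_comm]
      omega
    have hN' : ∀ k ∈ ((improvedUCB K T).run T p d b).plausible,
        pullCount ((improvedUCB K T).run T p d (b + 1)).choice
          ((improvedUCB K T).run T p d (b + 1)).time k = ucbPulls T (b + 1) := by
      intro k hk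
      rw [hA.pullCount_succ d hlt, hN k hk, hphase, slotCount_card_mul hk]
      have := ucbPulls_le_succ hT hb
      omega
    have hpos := ucbPulls_pos (b := b + 1) hT (Nat.succ_ne_zero b) hb
    have hplaus : ((improvedUCB K T).run T p d (b + 1)).plausible
        = confidenceTest (Real.log (T / (2 : ℝ) ^ (2 * (b + 1))) / 2)
          ((improvedUCB K T).run T p d b).plausible
          (pullCount ((improvedUCB K T).run T p d (b + 1)).choice
            ((improvedUCB K T).run T p d (b + 1)).time)
          (empMean p d ((improvedUCB K T).run T p d (b + 1)).choice
            ((improvedUCB K T).run T p d (b + 1)).time) := rfl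
    have hdev : ∀ k ∈ ((improvedUCB K T).run T p d b).plausible,
        pullCount ((improvedUCB K T).run T p d (b + 1)).choice
            ((improvedUCB K T).run T p d (b + 1)).time k = 0 ∨
          |empMean p d ((improvedUCB K T).run T p d (b + 1)).choice
              ((improvedUCB K T).run T p d (b + 1)).time k - p k * m k|
            ≤ √(Real.log (T / (2 : ℝ) ^ (2 * (b + 1))) / 2
              / pullCount ((improvedUCB K T).run T p d (b + 1)).choice
                ((improvedUCB K T).run T p d (b + 1)).time k) := by
      intro k hk
      right
      by_contra hcon
      refine hok b (by omega) ⟨k, hN' k hk, ?_⟩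
      rw [hN' k hk] at hcon
      exact not_le.1 hcon
    have hsub : ((improvedUCB K T).run T p d (b + 1)).plausible
        ⊆ ((improvedUCB K T).run T p d b).plausible := by
      rw [hplaus]; exact confidenceTest_subset
    refine ⟨fun k hk => hN' k (hsub hk), ?_, fun k hk => ?_⟩
    · rw [hplaus]
      refine best_mem_confidenceTest (v := fun k => p k * m k) haP (fun k => ?_) hdev
      have := rewardGap_nonneg p m k
      rw [ha] at this
      linarith
    · have hkP := hsub hk
      rw [hplaus] at hk
      have := sub_le_of_mem_confidenceTest (v := fun k => p k * m k) haP hdev hk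
        (by rw [hN' a haP]; omega) (by rw [hN' k hkP]; omega)
      rw [hN' a haP, hN' k hkP] at this
      have hr := sqrt_div_ucbPulls_le (b := b + 1) hT (Nat.succ_ne_zero b) hb
      rw [ha]
      linarith

/-- Survivors after `c` phases have gap at most $2\cdot2^{-c}$ and the next phase has at most
$n_{c+1}K$ steps, which gives the geometric terms. From the end of phase `b` on, nestedness bounds
every gap by $2\cdot2^{-b}$, even if later phases fail. -/
lemma improvedUCB_sum_gap_le (hT : 1 ≤ T) (hgap : ∀ k, rewardGap p m k ≤ 1)
    {d : ℕ → Fin K → ℝ} {b : ℕ} (hb : b ≤ ucbPhases T)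
    (hok : ∀ c < b, ¬ UCBFails T p m (c + 1) d) :
    ∑ t ∈ Finset.range T, rewardGap p m ((improvedUCB K T).prices T p d t)
      ≤ ∑ c ∈ Finset.range b, 16 * (1 + Real.log T) * K * 2 ^ c + 2 * T * (1 / 2) ^ b := by
  have hA := improvedUCB_isProper (K := K) (T := T) p
  have hnum : (improvedUCB K T).numPhases = ucbPhases T + 1 := rfl
  obtain ⟨a, ha⟩ := exists_rewardGap_eq p m
  have hlogT : 0 ≤ Real.log T := Real.log_nonneg (by exact_mod_cast hT)
  rw [← Finset.sum_range_add_sum_Ico _ ((improvedUCB K T).run_time_le T p d b),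
    hA.sum_range_time d _ (by omega : b ≤ (improvedUCB K T).numPhases)]
  refine add_le_add (Finset.sum_le_sum fun c hc => ?_) ?_
  · rw [Finset.mem_range] at hc
    have hinv := improvedUCB_invariant hT hgap ha (d := d) (by omega : c ≤ ucbPhases T)
      fun c' hc' => hok c' (by omega)
    have htime := improvedUCB_time_succ (p := p) d (by omega : c + 1 ≤ ucbPhases T)
    set R := (improvedUCB K T).run T p d c with hR
    set R' := (improvedUCB K T).run T p d (c + 1) with hR'
    rcases hinv with hfull | ⟨-, -, hg⟩
    · rw [Finset.Ico_eq_empty (by omega), Finset.sum_empty]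
      positivity
    · have hlen : R'.time - R.time ≤ ucbPulls T (c + 1) * K := by
        have h1 : R.plausible.card ≤ K := by simpa using R.plausible.card_le_univ
        have h2 : (ucbPulls T (c + 1) - ucbPulls T c) * R.plausible.card
            ≤ ucbPulls T (c + 1) * K := Nat.mul_le_mul (Nat.sub_le _ _) h1
        omega
      have hlen' : ((R'.time - R.time : ℕ) : ℝ)
          ≤ 2 ^ (2 * (c + 1) + 1) * (1 + Real.log T) * K := by
        refine (Nat.cast_le.2 hlen).trans ?_
        push_cast
        gcongr
        exact ucbPulls_le hT (c + 1)
      calc _ ≤ ∑ t ∈ Finset.Ico R.time R'.time, (2 * (1 / 2) ^ c : ℝ) := by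
            refine Finset.sum_le_sum fun t ht => ?_
            rw [Finset.mem_Ico] at ht
            exact hg _ (hA.prices_mem_plausible d (by omega) ht.1 ht.2)
        _ = ((R'.time - R.time : ℕ) : ℝ) * (2 * (1 / 2) ^ c) := by simp
        _ ≤ 2 ^ (2 * (c + 1) + 1) * (1 + Real.log T) * K * (2 * (1 / 2) ^ c) := by gcongr
        _ = 16 * (1 + Real.log T) * K * 2 ^ c := by
            rw [one_div, inv_pow, show (2 : ℝ) ^ (2 * (c + 1) + 1) = (2 ^ c) ^ 2 * 8 by ring]
            field_simp
            ring
  · set R := (improvedUCB K T).run T p d b with hR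
    rcases improvedUCB_invariant hT hgap ha hb hok with hfull | ⟨-, -, hg⟩
    · rw [Finset.Ico_eq_empty (by rw [hR, hfull]; exact lt_irrefl T), Finset.sum_empty]
      positivity
    · calc _ ≤ ∑ t ∈ Finset.Ico R.time T, (2 * (1 / 2) ^ b : ℝ) := by
            refine Finset.sum_le_sum fun t ht => ?_
            rw [Finset.mem_Ico] at ht
            refine hg _ (hA.prices_mem_of_nested d (fun c hbc _ =>
              PhasedAlgorithm.plausible_subset_of_test_subset
                (fun _ _ _ _ => confidenceTest_subset) d hbc)
              (by omega : b ≤ (improvedUCB K T).numPhases) le_rfl ht.1 ?_)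
            rw [hA.run_numPhases_time]
            exact ht.2
        _ = ((T - R.time : ℕ) : ℝ) * (2 * (1 / 2) ^ b) := by simp
        _ ≤ T * (2 * (1 / 2) ^ b) := by
            gcongr
            exact Nat.sub_le _ _
        _ = 2 * T * (1 / 2) ^ b := by ring

/-- Pathwise regret bound in terms of the failing phases. -/
lemma improvedUCB_sum_gap_le_of_fails (hT : 1 ≤ T) (hgap : ∀ k, rewardGap p m k ≤ 1)
    (d : ℕ → Fin K → ℝ) {b : ℕ} (hb : b ≤ ucbPhases T) :
    ∑ t ∈ Finset.range T, rewardGap p m ((improvedUCB K T).prices T p d t)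
      ≤ (∑ c ∈ Finset.range b, 16 * (1 + Real.log T) * K * 2 ^ c + 2 * T * (1 / 2) ^ b)
        + ∑ c ∈ Finset.range b, 2 * T * (1 / 2) ^ c
          * {d | UCBFails T p m (c + 1) d}.indicator (fun _ => (1 : ℝ)) d := by
  classical
  have hlogT : 0 ≤ Real.log T := Real.log_nonneg (by exact_mod_cast hT)
  have hterm : ∀ c, 0 ≤ 2 * T * (1 / 2 : ℝ) ^ c
      * {d | UCBFails T p m (c + 1) d}.indicator (fun _ => (1 : ℝ)) d := fun c =>
    mul_nonneg (by positivity) (Set.indicator_nonneg (fun _ _ => zero_le_one) _)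
  by_cases hok : ∀ c < b, ¬ UCBFails T p m (c + 1) d
  · exact (improvedUCB_sum_gap_le hT hgap hb hok).trans
      (le_add_of_nonneg_right (Finset.sum_nonneg fun c _ => hterm c))
  · push Not at hok
    -- The bound for good phases is applied up to the first failure; its tail term is charged to the
    -- indicator of that failure.
    obtain ⟨hcb, hfail⟩ := Nat.find_spec hok
    have hmin : ∀ c < Nat.find hok, ¬ UCBFails T p m (c + 1) d := fun c hc hf =>
      Nat.find_min hok hc ⟨hc.trans hcb, hf⟩
    refine (improvedUCB_sum_gap_le hT hgap (by omega) hmin).trans (add_le_add ?_ ?_)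
    · refine le_add_of_le_of_nonneg ?_ (by positivity)
      exact Finset.sum_le_sum_of_subset_of_nonneg (Finset.range_mono hcb.le)
        fun _ _ _ => by positivity
    · refine le_trans (le_of_eq ?_) (Finset.single_le_sum (fun c _ => hterm c)
        (Finset.mem_range.2 hcb))
      rw [Set.indicator_of_mem (s := {d | UCBFails T p m (Nat.find hok + 1) d}) hfail, mul_one]

/-- Failure after `c` good phases costs $2T2^{-c}$ with probability at most $2K4^{c+1}/T$, in
expectation $16K2^c$: the same geometric sum as exploration. At the cutoff phase, exploration,
failures and tail give $16(1+\log T)+16+8$ times $\sqrt{KT}$. -/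
lemma improvedUCB_regret_le {Ω : Type*} [MeasurableSpace Ω] {μ : Measure Ω}
    [IsProbabilityMeasure μ] {D : ℕ → Fin K → Ω → ℝ} (hT : 1 ≤ T) (hKT : K ≤ T)
    (hpm : Monotone p) (hp : ∀ k, p k ∈ Set.Icc (0 : ℝ) 1) (hD : IsIndepDemand μ T D m) (M : ℕ) :
    T * Finset.univ.sup' Finset.univ_nonempty (fun k : Fin K => p k * m k)
      - ∫ ω, revenue p T M ((improvedUCB K T).prices T p (fun t k => D t k ω))
        (fun t k => D t k ω) ∂μ
    ≤ 40 * (1 + Real.log T) * √((K : ℝ) * T) + (1 + Real.log T) * M := by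
  have hA := improvedUCB_isProper (K := K) (T := T) p
  have hnum : (improvedUCB K T).numPhases = ucbPhases T + 1 := rfl
  have hT0 : (0 : ℝ) < T := by exact_mod_cast hT
  have hlogT : 0 ≤ Real.log T := Real.log_nonneg (by exact_mod_cast hT)
  obtain ⟨b, hb, hb1, hb2⟩ := exists_cutoff_phase (NeZero.one_le (n := K)) hKT
  refine (hA.regret_le_of_forall_le hp hD M
    (fun d hd => hA.sum_sub_revenue_le_numPhases_mul hpm hp hd M)
    (∑ c ∈ Finset.range b, 16 * (1 + Real.log T) * K * 2 ^ c + 2 * T * (1 / 2) ^ b)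
    (Finset.range b) (c := fun c => 2 * T * (1 / 2) ^ c) (fun _ _ => by positivity)
    (fun c => {ω | UCBFails T p m (c + 1) fun t k => D t k ω})
    (fun ω => improvedUCB_sum_gap_le_of_fails hT
      (rewardGap_le_one hp (hD.mean_mem_Icc hT)) _ hb)).trans ?_
  have hgeom : ∑ c ∈ Finset.range b, (2 : ℝ) ^ c ≤ 2 ^ b := by
    rw [geom_sum_eq (by norm_num)]
    norm_num
  have hfail : ∑ c ∈ Finset.range b, 2 * T * (1 / 2 : ℝ) ^ c
        * μ.real {ω | UCBFails T p m (c + 1) fun t k => D t k ω}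
      ≤ ∑ c ∈ Finset.range b, 16 * K * (2 : ℝ) ^ c := by
    refine Finset.sum_le_sum fun c hc => ?_
    rw [Finset.mem_range] at hc
    have h1 := one_le_log_of_le_ucbPhases hT (Nat.succ_ne_zero c) (by omega)
    have h2 := hA.measureReal_exists_deviates_le hp hD (b := c + 1) (by omega)
      (ucbPulls_pos hT (Nat.succ_ne_zero c) (by omega))
      (by linarith : 0 ≤ Real.log (T / (2 : ℝ) ^ (2 * (c + 1))) / 2)
    rw [exp_neg_log_div_two hT] at h2
    calc _ ≤ 2 * T * (1 / 2 : ℝ) ^ c * (2 * K * (2 ^ (2 * (c + 1)) / T)) := by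
          gcongr
          exact h2
      _ = 16 * K * 2 ^ c := by
          rw [one_div, inv_pow, show (2 : ℝ) ^ (2 * (c + 1)) = (2 ^ c) ^ 2 * 4 by ring]
          field_simp
          ring
  have hphases : ((improvedUCB K T).numPhases : ℝ) ≤ 1 + Real.log T := by
    rw [hnum]
    push_cast
    exact ucbPhases_add_one_le hT
  have hM : ((improvedUCB K T).numPhases : ℝ) * M ≤ (1 + Real.log T) * M := by gcongr
  rw [← Finset.mul_sum] at hfail ⊢
  have hK1 : (K : ℝ) * ∑ c ∈ Finset.range b, (2 : ℝ) ^ c ≤ √((K : ℝ) * T) :=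
    (mul_le_mul_of_nonneg_left hgeom (Nat.cast_nonneg K)).trans hb1
  have h1 : 16 * (1 + Real.log T) * K * ∑ c ∈ Finset.range b, (2 : ℝ) ^ c
      ≤ 16 * (1 + Real.log T) * √((K : ℝ) * T) := by
    rw [mul_assoc _ (K : ℝ)]
    gcongr
  have h2 : (0 : ℝ) ≤ Real.log T * √((K : ℝ) * T) := by positivity
  nlinarith

end

lemma pullCount_le {K : ℕ} (i : ℕ → Fin K) (t : ℕ) (k : Fin K) : pullCount i t k ≤ t :=
  (Finset.card_filter_le _ _).trans (Finset.card_range t).le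

/-! ### The grid of batched elimination -/

section

variable {T : ℕ}

lemma batchGrid_zero (T : ℕ) : batchGrid T 0 = 1 := by
  simp [batchGrid]

/-- The exponents $e_b=2-2^{1-b}$ satisfy $e_{b+1}=1+e_b/2$. This recursion equalizes the cost of
the phases. -/
lemma batchGrid_succ (hT : 1 ≤ T) (b : ℕ) :
    batchGrid T (b + 1) = √(Real.exp 1 * T) * √(batchGrid T b) := by
  have ha : 0 < √(Real.exp 1 * T) := zero_lt_one.trans_le (one_le_sqrt_exp_mul hT)
  rw [batchGrid, batchGrid, Real.sqrt_eq_rpow (√(Real.exp 1 * T) ^ _), ← Real.rpow_mul ha.le]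
  nth_rw 2 [← Real.rpow_one √(Real.exp 1 * T)]
  rw [← Real.rpow_add ha]
  congr 1
  push_cast
  rw [show (1 : ℝ) - (b + 1) = (1 - b) - 1 by ring, Real.rpow_sub_one two_ne_zero]
  ring

lemma one_le_batchGrid (hT : 1 ≤ T) (b : ℕ) : 1 ≤ batchGrid T b := by
  rw [← batchGrid_zero T]
  exact batchGrid_mono hT (Nat.zero_le b)

/-- The number of phases of batched elimination. -/
noncomputable def batchPhases (T : ℕ) : ℕ := max 1 ⌈Real.logb 2 (Real.log (Real.exp 1 * T))⌉₊

lemma log_exp_one_mul (hT : 1 ≤ T) : Real.log (Real.exp 1 * T) = 1 + Real.log T := by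
  have hT0 : (0 : ℝ) < T := by exact_mod_cast hT
  rw [Real.log_mul (Real.exp_pos 1).ne' hT0.ne', Real.log_exp]

/-- The grid value is $(eT)^{1-2^{-B}}$, and $2^B\ge\log(eT)$ means that the missing factor
$(eT)^{2^{-B}}$ is at most $e$. -/
lemma le_batchGrid_batchPhases (hT : 1 ≤ T) : (T : ℝ) ≤ batchGrid T (batchPhases T) := by
  have hT1 : (1 : ℝ) ≤ T := by exact_mod_cast hT
  have hT0 : (0 : ℝ) < T := by linarith
  have hlogT := Real.log_nonneg hT1
  have ha : 0 < √(Real.exp 1 * T) := zero_lt_one.trans_le (one_le_sqrt_exp_mul hT)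
  set B := batchPhases T with hB
  have h1 : Real.logb 2 (Real.log (Real.exp 1 * T)) ≤ B :=
    (Nat.le_ceil _).trans (Nat.cast_le.2 (le_max_right _ _))
  rw [log_exp_one_mul hT, Real.logb_le_iff_le_rpow one_lt_two (by linarith)] at h1
  rw [batchGrid, Real.le_rpow_iff_log_le hT0 ha, Real.log_sqrt (by positivity),
    log_exp_one_mul hT, Real.rpow_sub two_pos, Real.rpow_one]
  have h2 : (0 : ℝ) < 2 ^ (B : ℝ) := by positivity
  have h3 : (1 + Real.log T) / 2 ^ (B : ℝ) ≤ 1 := (div_le_one h2).2 h1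
  have h4 : (2 - 2 / 2 ^ (B : ℝ)) * ((1 + Real.log T) / 2)
      = 1 + Real.log T - (1 + Real.log T) / 2 ^ (B : ℝ) := by
    field_simp
  linarith

lemma batchPhases_le (hT : 1 ≤ T) : (batchPhases T : ℝ) ≤ 2 * (1 + Real.log T) := by
  have hT1 : (1 : ℝ) ≤ T := by exact_mod_cast hT
  have hlogT := Real.log_nonneg hT1
  have h2 := Real.log_two_gt_d9
  rw [batchPhases, Nat.cast_max, max_le_iff]
  refine ⟨by push_cast; linarith, ?_⟩
  have h0 : 0 ≤ Real.logb 2 (Real.log (Real.exp 1 * T)) := by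
    rw [log_exp_one_mul hT]
    exact Real.logb_nonneg one_lt_two (by linarith)
  refine (Nat.ceil_lt_add_one h0).le.trans ?_
  rw [log_exp_one_mul hT, Real.logb]
  have h3 := Real.log_le_sub_one_of_pos (by linarith : 0 < 1 + Real.log T)
  have h4 : Real.log (1 + Real.log T) / Real.log 2 ≤ 2 * Real.log T := by
    rw [div_le_iff₀ (by linarith)]
    nlinarith
  linarith

variable {K : ℕ} [NeZero K] {p m : Fin K → ℝ} {d : ℕ → Fin K → ℝ} {b : ℕ}

lemma batchedElimination_time_le (hT : 1 ≤ T) (hb : b ≤ batchPhases T) :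
    (((batchedElimination K T).run T p d b).time : ℝ) ≤ 2 * batchGrid T b := by
  have hx := one_le_batchGrid hT b
  have hnum : (batchedElimination K T).numPhases = batchPhases T := rfl
  rcases hb.eq_or_lt with rfl | hlt
  · have h1 : (((batchedElimination K T).run T p d (batchPhases T)).time : ℝ) ≤ T := by
      exact_mod_cast PhasedAlgorithm.run_time_le _ _ _ _ _
    linarith [le_batchGrid_batchPhases hT]
  cases b with
  | zero =>
    rw [PhasedAlgorithm.run_zero_time]
    push_cast
    linarith
  | succ b =>
    rw [batchedElimination_time p d (by omega)]
    refine (Nat.cast_le.2 (min_le_left _ _)).trans ?_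
    refine (Nat.ceil_lt_add_one (by linarith)).le.trans ?_
    linarith

/-- Each phase of batched elimination is short compared to the square root of the time at which
it starts. -/
lemma batchedElimination_time_succ_le (hT : 1 ≤ T) (hb0 : b ≠ 0) (hb : b < batchPhases T) :
    (((batchedElimination K T).run T p d (b + 1)).time : ℝ)
      ≤ 2 * √(Real.exp 1 * T) * √((batchedElimination K T).run T p d b).time := by
  have hnum : (batchedElimination K T).numPhases = batchPhases T := rfl
  obtain ⟨c, rfl⟩ := Nat.exists_eq_succ_of_ne_zero hb0
  have ht := batchedElimination_time p d (K := K) (T := T) (b := c) hb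
  rw [Nat.succ_eq_add_one, ht]
  rcases le_total ⌈batchGrid T (c + 1)⌉₊ T with h | h
  · rw [min_eq_left h]
    refine (batchedElimination_time_le hT hb).trans ?_
    rw [Nat.succ_eq_add_one, batchGrid_succ hT, mul_assoc]
    gcongr
    exact Nat.le_ceil _
  -- The horizon is already reached, and $T=\sqrt T\sqrt T\le\sqrt{eT}\sqrt T$.
  · rw [min_eq_right h]
    have h1 : (((batchedElimination K T).run T p d (c + 1 + 1)).time : ℝ) ≤ T := by
      exact_mod_cast PhasedAlgorithm.run_time_le _ _ _ _ _
    refine h1.trans ?_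
    have h2 : √(T : ℝ) ≤ √(Real.exp 1 * T) := Real.sqrt_le_sqrt
      (le_mul_of_one_le_left (Nat.cast_nonneg T) (Real.one_le_exp zero_le_one))
    have h3 := Real.mul_self_sqrt (Nat.cast_nonneg (α := ℝ) T)
    have h4 := Real.sqrt_nonneg (T : ℝ)
    nlinarith [mul_le_mul_of_nonneg_right h2 h4]

/-! ### Regret of batched elimination -/

/-- Some price has an empirical mean outside of the confidence radius at the end of some phase of
batched elimination. -/
def BatchFails (T : ℕ) (p m : Fin K → ℝ) (d : ℕ → Fin K → ℝ) : Prop :=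
  ∃ x ∈ Finset.range (batchPhases T) ×ˢ Finset.Icc 1 T, ∃ k,
    (batchedElimination K T).Deviates T p m x.1 (3 * Real.log (K * T)) x.2 k d

lemma batchedElimination_deviation_le (hok : ¬ BatchFails T p m d) (hb : b < batchPhases T)
    (k : Fin K) :
    pullCount ((batchedElimination K T).run T p d b).choice
        ((batchedElimination K T).run T p d b).time k = 0 ∨
      |empMean p d ((batchedElimination K T).run T p d b).choice
          ((batchedElimination K T).run T p d b).time k - p k * m k|
        ≤ √(3 * Real.log (K * T) / pullCount ((batchedElimination K T).run T p d b).choice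
            ((batchedElimination K T).run T p d b).time k) := by
  by_contra! hcon
  refine hok ⟨(b, pullCount ((batchedElimination K T).run T p d b).choice
        ((batchedElimination K T).run T p d b).time k), ?_, k, rfl, hcon.2⟩
  rw [Finset.mem_product, Finset.mem_range, Finset.mem_Icc]
  exact ⟨hb, Nat.one_le_iff_ne_zero.2 hcon.1,
    (pullCount_le _ _ _).trans (PhasedAlgorithm.run_time_le _ _ _ _ _)⟩

/-- A phase of length $\ell$ gives each survivor more than $\ell/K-1$ pulls, so rounding loses at
most one pull per phase; this is the summand `b`. Prices without pulls cannot eliminate or be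
eliminated, so the best price is safe even in very short phases. -/
lemma batchedElimination_invariant (hT : 1 ≤ T) {a : Fin K}
    (ha : ∀ k, rewardGap p m k = p a * m a - p k * m k) (hok : ¬ BatchFails T p m d)
    (hb : b < batchPhases T) :
    a ∈ ((batchedElimination K T).run T p d b).plausible ∧
      ∀ k ∈ ((batchedElimination K T).run T p d b).plausible,
        ((batchedElimination K T).run T p d b).time
          ≤ K * (pullCount ((batchedElimination K T).run T p d b).choice
            ((batchedElimination K T).run T p d b).time k + b) := by
  have hA := batchedElimination_isProper (K := K) hT p
  have hnum : (batchedElimination K T).numPhases = batchPhases T := rfl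
  induction b with
  | zero => exact ⟨Finset.mem_univ a, fun k _ => Nat.zero_le _⟩
  | succ b ih =>
    obtain ⟨haP, hN⟩ := ih (by omega)
    have hle := hA.time_le_succ d b (by omega)
    refine ⟨?_, fun k hk => ?_⟩
    · refine best_mem_confidenceTest (v := fun k => p k * m k) haP (fun k => ?_)
        fun k _ => batchedElimination_deviation_le hok hb k
      have := rewardGap_nonneg p m k
      rw [ha] at this
      linarith
    · have hkP : k ∈ ((batchedElimination K T).run T p d b).plausible := confidenceTest_subset hk
      have h1 := hN k hkP
      have h2 := lt_card_mul_slotCount_add_one hkP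
        (((batchedElimination K T).run T p d (b + 1)).time
          - ((batchedElimination K T).run T p d b).time)
      have h3 : ((batchedElimination K T).run T p d b).plausible.card ≤ K := by
        simpa using ((batchedElimination K T).run T p d b).plausible.card_le_univ
      have h4 := h2.trans_le (Nat.mul_le_mul_right _ h3)
      rw [hA.pullCount_succ d (by omega)]
      rw [mul_add] at h1 h4 ⊢
      rw [mul_add, mul_add]
      omega

lemma batchedElimination_gap_le (hT : 1 ≤ T) (hok : ¬ BatchFails T p m d) (hb0 : b ≠ 0)
    (hb : b < batchPhases T) (htime : 2 * b * K ≤ ((batchedElimination K T).run T p d b).time)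
    {k : Fin K} (hk : k ∈ ((batchedElimination K T).run T p d b).plausible) :
    rewardGap p m k ≤ 4 * √(2 * K * (3 * Real.log (K * T))
      / ((batchedElimination K T).run T p d b).time) := by
  obtain ⟨a, ha⟩ := exists_rewardGap_eq p m
  obtain ⟨c, rfl⟩ := Nat.exists_eq_succ_of_ne_zero hb0
  rw [Nat.succ_eq_add_one] at *
  obtain ⟨haP, hN⟩ := batchedElimination_invariant hT ha hok hb
  obtain ⟨haP', -⟩ := batchedElimination_invariant hT ha hok (by omega : c < batchPhases T)
  have hK : 1 ≤ K := NeZero.one_le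
  have hlog : 0 ≤ 3 * Real.log (K * T) := by
    have : (1 : ℝ) ≤ K * T := by exact_mod_cast Nat.mul_pos hK hT
    have := Real.log_nonneg this
    positivity
  have hK0 : (0 : ℝ) < K := by exact_mod_cast hK
  have hr : ∀ j ∈ ((batchedElimination K T).run T p d (c + 1)).plausible,
      pullCount ((batchedElimination K T).run T p d (c + 1)).choice
        ((batchedElimination K T).run T p d (c + 1)).time j ≠ 0 ∧
      √(3 * Real.log (K * T) / pullCount ((batchedElimination K T).run T p d (c + 1)).choice
            ((batchedElimination K T).run T p d (c + 1)).time j)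
        ≤ √(2 * K * (3 * Real.log (K * T))
          / ((batchedElimination K T).run T p d (c + 1)).time) := by
    intro j hj
    have h1 := hN j hj
    set τ := ((batchedElimination K T).run T p d (c + 1)).time
    set N := pullCount ((batchedElimination K T).run T p d (c + 1)).choice τ j
    -- By `htime` the rounding loss $Kb$ is at most half of the elapsed time.
    have h2 : τ ≤ 2 * K * N := by
      have : 2 * (c + 1) * K = 2 * (K * (c + 1)) := by ring
      rw [mul_add] at h1
      have : 2 * K * N = 2 * (K * N) := by ring
      omega
    have hτ : 0 < τ := lt_of_lt_of_le (by positivity) htime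
    have hN0 : N ≠ 0 := by
      rintro h0
      rw [h0] at h2
      omega
    refine ⟨hN0, Real.sqrt_le_sqrt ?_⟩
    have hN1 : (0 : ℝ) < N := by exact_mod_cast Nat.pos_of_ne_zero hN0
    have hτ1 : (0 : ℝ) < τ := by exact_mod_cast hτ
    have h3 : (τ : ℝ) ≤ 2 * K * N := by exact_mod_cast h2
    rw [div_le_div_iff₀ hN1 hτ1]
    nlinarith
  have h1 := sub_le_of_mem_confidenceTest (v := fun k => p k * m k) haP'
    (fun k _ => batchedElimination_deviation_le hok hb k) hk (hr a haP).1 (hr k hk).1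
  rw [ha]
  linarith [(hr a haP).2, (hr k hk).2]

lemma sum_Ico_le_of_le {f : ℕ → ℝ} {u v : ℕ} {x : ℝ} (hx : 0 ≤ x)
    (h : ∀ t, u ≤ t → t < v → f t ≤ x) : ∑ t ∈ Finset.Ico u v, f t ≤ v * x := by
  refine (Finset.sum_le_card_nsmul _ _ x fun t ht => ?_).trans ?_
  · rw [Finset.mem_Ico] at ht
    exact h t ht.1 ht.2
  · rw [Nat.card_Ico, nsmul_eq_mul]
    gcongr
    exact Nat.sub_le _ _

/-- The three summands bound three kinds of phase: the first one; one that starts before time $2bK$,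
where rounding may spoil the pull counts and gaps are bounded by 1; and a regular one, where
$\sqrt\tau$ cancels between phase length and gap. -/
lemma batchedElimination_phase_gap_le (hT : 1 ≤ T) (hgap : ∀ k, rewardGap p m k ≤ 1)
    (hok : ¬ BatchFails T p m d) (hb : b < batchPhases T) :
    ∑ t ∈ Finset.Ico ((batchedElimination K T).run T p d b).time
        ((batchedElimination K T).run T p d (b + 1)).time,
      rewardGap p m ((batchedElimination K T).prices T p d t)
    ≤ 2 * √(Real.exp 1 * T) + 2 * √(Real.exp 1 * T) * √(2 * K * batchPhases T)
      + 8 * √(Real.exp 1 * T) * √(2 * K * (3 * Real.log (K * T))) := by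
  have hA := batchedElimination_isProper (K := K) hT p
  have hnum : (batchedElimination K T).numPhases = batchPhases T := rfl
  set x := √(Real.exp 1 * T) with hx
  have hx0 : 0 ≤ x := Real.sqrt_nonneg _
  have hy0 := Real.sqrt_nonneg (2 * K * batchPhases T)
  have hz0 := Real.sqrt_nonneg (2 * K * (3 * Real.log (K * T)))
  have hxy := mul_nonneg hx0 hy0
  have hxz := mul_nonneg hx0 hz0
  have htriv := sum_Ico_le_of_le (f := fun t => rewardGap p m
      ((batchedElimination K T).prices T p d t))
      (u := ((batchedElimination K T).run T p d b).time)
      (v := ((batchedElimination K T).run T p d (b + 1)).time) zero_le_one fun t _ _ => hgap _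
  rw [mul_one] at htriv
  rcases eq_or_ne b 0 with rfl | hb0
  · have h1 := batchedElimination_time_le (K := K) (p := p) (d := d) hT (b := 0 + 1) hb
    rw [batchGrid_succ hT, batchGrid_zero, Real.sqrt_one, mul_one, ← hx] at h1
    linarith
  have hstep := batchedElimination_time_succ_le (K := K) (p := p) (d := d) hT hb0 hb
  rw [← hx] at hstep
  rcases le_total (2 * b * K) ((batchedElimination K T).run T p d b).time with h | h
  · have hK : 1 ≤ K := NeZero.one_le
    set τ := ((batchedElimination K T).run T p d b).time with hτ
    have hτ0 : (0 : ℝ) < τ := by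
      have : 0 < τ := lt_of_lt_of_le (by positivity) h
      exact_mod_cast this
    refine (sum_Ico_le_of_le (by positivity) fun t ht ht' => batchedElimination_gap_le hT hok hb0 hb
      h (hA.prices_mem_plausible d (by omega) ht ht')).trans ?_
    have h1 : √(2 * K * (3 * Real.log (K * T)) / τ) * √τ = √(2 * K * (3 * Real.log (K * T))) := by
      rw [Real.sqrt_div' _ hτ0.le, div_mul_cancel₀ _ (Real.sqrt_pos.2 hτ0).ne']
    calc _ ≤ 2 * x * √τ * (4 * √(2 * K * (3 * Real.log (K * T)) / τ)) := by gcongr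
      _ = 8 * x * (√(2 * K * (3 * Real.log (K * T)) / τ) * √τ) := by ring
      _ = 8 * x * √(2 * K * (3 * Real.log (K * T))) := by rw [h1]
      _ ≤ _ := by nlinarith
  · have h1 : √(((batchedElimination K T).run T p d b).time : ℝ) ≤ √(2 * K * batchPhases T) := by
      apply Real.sqrt_le_sqrt
      have : 2 * b * K ≤ 2 * K * batchPhases T := by nlinarith
      exact_mod_cast h.trans this
    have h2 := mul_le_mul_of_nonneg_left h1 (by positivity : 0 ≤ 2 * x)
    nlinarith

/-- Pull counts are random here, because of rounding and of random survivor sets, so the union bound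
also runs over all counts up to `T`. The radius constant 3 makes each event have probability at most
$2K(KT)^{-6}$, which leaves ample room. -/
lemma measureReal_batchFails_le {Ω : Type*} [MeasurableSpace Ω] {μ : Measure Ω}
    [IsProbabilityMeasure μ] {D : ℕ → Fin K → Ω → ℝ} (hT : 1 ≤ T)
    (hp : ∀ k, p k ∈ Set.Icc (0 : ℝ) 1) (hD : IsIndepDemand μ T D m) :
    T * μ.real {ω | BatchFails T p m fun t k => D t k ω} ≤ 2 * batchPhases T := by
  have hA := batchedElimination_isProper (K := K) hT p
  have hnum : (batchedElimination K T).numPhases = batchPhases T := rfl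
  have hK : (1 : ℝ) ≤ K := by exact_mod_cast NeZero.one_le (n := K)
  have hT1 : (1 : ℝ) ≤ T := by exact_mod_cast hT
  have hKT : (1 : ℝ) ≤ K * T := by nlinarith
  have hlog := Real.log_nonneg hKT
  have hexp : Real.exp (-(2 * (3 * Real.log (K * T)))) = ((K * T : ℝ) ^ 6)⁻¹ := by
    rw [Real.exp_neg, show 2 * (3 * Real.log (K * T)) = (6 : ℕ) * Real.log (K * T) by
      push_cast; ring, Real.exp_nat_mul, Real.exp_log (by linarith)]
  have hset : {ω | BatchFails T p m fun t k => D t k ω}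
      = ⋃ x ∈ Finset.range (batchPhases T) ×ˢ Finset.Icc 1 T, {ω | ∃ k,
        (batchedElimination K T).Deviates T p m x.1 (3 * Real.log (K * T)) x.2 k
          fun t k => D t k ω} := by
    ext ω
    simp only [BatchFails, Set.mem_ofPred_eq, Set.mem_iUnion, exists_prop]
  have h1 : μ.real {ω | BatchFails T p m fun t k => D t k ω}
      ≤ batchPhases T * T * (2 * K * ((K * T : ℝ) ^ 6)⁻¹) := by
    rw [hset]
    refine (measureReal_biUnion_finset_le _ _).trans ?_
    refine (Finset.sum_le_card_nsmul _ _ (2 * K * ((K * T : ℝ) ^ 6)⁻¹) fun x hx => ?_).trans ?_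
    · rw [Finset.mem_product, Finset.mem_range, Finset.mem_Icc] at hx
      rw [← hexp]
      exact hA.measureReal_exists_deviates_le hp hD (by omega) (by omega) (by positivity)
    · simp
  have h2 : (T : ℝ) * T * K ≤ (K * T) ^ 6 := by
    calc (T : ℝ) * T * K ≤ T * T * K * K := le_mul_of_one_le_right (by positivity) hK
      _ = (K * T) ^ 2 := by ring
      _ ≤ (K * T) ^ 6 := pow_le_pow_right₀ hKT (by norm_num)
  have h3 : (T : ℝ) * T * K * ((K * T : ℝ) ^ 6)⁻¹ ≤ 1 := by
    rw [← div_eq_mul_inv]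
    exact (div_le_one (by positivity)).2 h2
  calc _ ≤ T * (batchPhases T * T * (2 * K * ((K * T : ℝ) ^ 6)⁻¹)) := by gcongr
    _ = 2 * batchPhases T * (T * T * K * ((K * T : ℝ) ^ 6)⁻¹) := by ring
    _ ≤ 2 * batchPhases T * 1 := by gcongr
    _ = _ := mul_one _

lemma batchedElimination_regret_le {Ω : Type*} [MeasurableSpace Ω] {μ : Measure Ω}
    [IsProbabilityMeasure μ] {D : ℕ → Fin K → Ω → ℝ} (hT : 1 ≤ T)
    (hpm : Monotone p) (hp : ∀ k, p k ∈ Set.Icc (0 : ℝ) 1) (hD : IsIndepDemand μ T D m) (M : ℕ) :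
    T * Finset.univ.sup' Finset.univ_nonempty (fun k : Fin K => p k * m k)
      - ∫ ω, revenue p T M ((batchedElimination K T).prices T p (fun t k => D t k ω))
        (fun t k => D t k ω) ∂μ
    ≤ 124 * (1 + Real.log (K * T)) ^ 2 * √((K : ℝ) * T) + 2 * (1 + Real.log (K * T)) * M := by
  have hA := batchedElimination_isProper (K := K) hT p
  have hnum : (batchedElimination K T).numPhases = batchPhases T := rfl
  have hgap : ∀ k, rewardGap p m k ≤ 1 := rewardGap_le_one hp (hD.mean_mem_Icc hT)
  have hK : (1 : ℝ) ≤ K := by exact_mod_cast NeZero.one_le (n := K)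
  have hT1 : (1 : ℝ) ≤ T := by exact_mod_cast hT
  have hKT : (1 : ℝ) ≤ K * T := by nlinarith
  have hlog := Real.log_nonneg hKT
  set Λ := 1 + Real.log (K * T) with hΛ
  have hΛ1 : 1 ≤ Λ := by linarith
  set c := 2 * √(Real.exp 1 * T) + 2 * √(Real.exp 1 * T) * √(2 * K * batchPhases T)
      + 8 * √(Real.exp 1 * T) * √(2 * K * (3 * Real.log (K * T))) with hc
  have hc0 : 0 ≤ c := by positivity
  have hpath : ∀ d : ℕ → Fin K → ℝ,
      ∑ t ∈ Finset.range T, rewardGap p m ((batchedElimination K T).prices T p d t)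
        ≤ batchPhases T * c + T * {d | BatchFails T p m d}.indicator (fun _ => (1 : ℝ)) d := by
    intro d
    by_cases hok : BatchFails T p m d
    · rw [Set.indicator_of_mem (s := {d | BatchFails T p m d}) hok]
      have : ∑ t ∈ Finset.range T, rewardGap p m ((batchedElimination K T).prices T p d t) ≤ T := by
        refine (Finset.sum_le_sum fun t _ => hgap _).trans ?_
        simp
      nlinarith [mul_nonneg (Nat.cast_nonneg (α := ℝ) (batchPhases T)) hc0]
    · rw [Set.indicator_of_notMem (s := {d | BatchFails T p m d}) hok, mul_zero, add_zero,
        hA.sum_range_horizon d]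
      refine (Finset.sum_le_sum fun b hb =>
        batchedElimination_phase_gap_le hT hgap hok (Finset.mem_range.1 hb)).trans ?_
      rw [Finset.sum_const, Finset.card_range, nsmul_eq_mul]
  refine (hA.regret_le_of_forall_le hp hD M
    (fun d hd => hA.sum_sub_revenue_le_numPhases_mul hpm hp hd M)
    (batchPhases T * c) ({()} : Finset Unit) (c := fun _ => T) (fun _ _ => by positivity)
    (fun _ => {ω | BatchFails T p m fun t k => D t k ω})
    (fun ω => by rw [Finset.sum_singleton]; exact hpath _)).trans ?_
  rw [Finset.sum_singleton, hnum]
  have hfail := measureReal_batchFails_le hT hp hD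
  have hB : (batchPhases T : ℝ) ≤ 2 * Λ := by
    refine (batchPhases_le hT).trans ?_
    have := Real.log_le_log (by linarith) (by nlinarith : (T : ℝ) ≤ K * T)
    linarith
  set S := √((K : ℝ) * T) with hS
  have hS1 : 1 ≤ S := Real.one_le_sqrt.2 hKT
  have hx : √(Real.exp 1 * T) ≤ 2 * √(T : ℝ) := by
    rw [← Real.sqrt_sq (zero_le_two (α := ℝ)), ← Real.sqrt_mul (by positivity)]
    apply Real.sqrt_le_sqrt
    have := Real.exp_one_lt_d9
    nlinarith
  have hST : √(T : ℝ) * √(K : ℝ) = S := by rw [hS, mul_comm (K : ℝ), Real.sqrt_mul (by linarith)]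
  have hTS : √(T : ℝ) ≤ S := Real.sqrt_le_sqrt (by nlinarith)
  have hy : √(2 * K * batchPhases T) ≤ 2 * Λ * √(K : ℝ) := by
    rw [← Real.sqrt_sq (by linarith : 0 ≤ 2 * Λ), ← Real.sqrt_mul (by positivity)]
    apply Real.sqrt_le_sqrt
    have h1 : (batchPhases T : ℝ) ≤ 2 * Λ ^ 2 := by nlinarith
    nlinarith
  have hz : √(2 * K * (3 * Real.log (K * T))) ≤ 3 * Λ * √(K : ℝ) := by
    rw [← Real.sqrt_sq (by linarith : 0 ≤ 3 * Λ), ← Real.sqrt_mul (by positivity)]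
    apply Real.sqrt_le_sqrt
    have h1 : 6 * Real.log (K * T) ≤ (3 * Λ) ^ 2 := by nlinarith
    nlinarith
  have hcS : c ≤ 60 * Λ * S := by
    calc c ≤ 2 * (2 * √(T : ℝ)) + 2 * (2 * √(T : ℝ)) * (2 * Λ * √(K : ℝ))
          + 8 * (2 * √(T : ℝ)) * (3 * Λ * √(K : ℝ)) := by rw [hc]; gcongr
      _ = 4 * √(T : ℝ) + 56 * Λ * (√(T : ℝ) * √(K : ℝ)) := by ring
      _ ≤ 4 * S + 56 * Λ * S := by rw [hST]; gcongr
      _ ≤ 60 * Λ * S := by nlinarith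
  have hBc : batchPhases T * c ≤ 2 * Λ * (60 * Λ * S) := by gcongr
  have hBM : (batchPhases T : ℝ) * M ≤ 2 * Λ * M := by gcongr
  -- The constant 124 consists of $2\cdot60$ from the phases and 4 from the failure event.
  have hΛS : Λ ≤ Λ ^ 2 * S := by nlinarith [mul_le_mul hΛ1 hS1 zero_le_one (by linarith)]
  linarith

end

/-! ### Regret of explore-then-commit -/

section

variable {K : ℕ} [NeZero K] {T : ℕ} {p m : Fin K → ℝ} {tie : Finset (Fin K) → Fin K}

/-- The number of times that explore-then-commit explores each price. -/
noncomputable def etcPulls (K T : ℕ) : ℕ := ⌈(K : ℝ) ^ (-(2 : ℝ) / 3) * (T : ℝ) ^ ((2 : ℝ) / 3)⌉₊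

/-- Some price has an empirical mean that is far off after exploration. -/
def ETCFails (T : ℕ) (tie : Finset (Fin K) → Fin K) (p m : Fin K → ℝ)
    (d : ℕ → Fin K → ℝ) : Prop :=
  ∃ k, (exploreThenCommit K T tie).Deviates T p m 1 (3 * Real.log (K * T)) (etcPulls K T) k d

lemma exploreThenCommit_time_one (hq : K * etcPulls K T ≤ T) (d : ℕ → Fin K → ℝ) :
    ((exploreThenCommit K T tie).run T p d 1).time = K * etcPulls K T := by
  have h : ((exploreThenCommit K T tie).run T p d 1).time = min (K * etcPulls K T) T := by
    rw [PhasedAlgorithm.run_succ_time, if_neg (by simp [exploreThenCommit])]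
    rfl
  rw [h, min_eq_left hq]

lemma exploreThenCommit_pullCount (hq : K * etcPulls K T ≤ T) (d : ℕ → Fin K → ℝ) (k : Fin K) :
    pullCount ((exploreThenCommit K T tie).run T p d 1).choice
      ((exploreThenCommit K T tie).run T p d 1).time k = etcPulls K T := by
  have hA := exploreThenCommit_isProper (T := T) tie p
  rw [hA.pullCount_succ d (b := 0) two_pos, exploreThenCommit_time_one hq]
  have h := slotCount_card_mul (Finset.mem_univ k) (etcPulls K T)
  rw [Finset.card_univ, Fintype.card_fin] at h
  simpa [PhasedAlgorithm.run_zero_time, PhasedAlgorithm.run_zero_plausible, pullCount] using h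

lemma le_of_mem_exploreThenCommit_test (htie : ∀ S : Finset (Fin K), S.Nonempty → tie S ∈ S)
    {b : ℕ} {P : Finset (Fin K)} {N : Fin K → ℕ} {lam : Fin K → ℝ} {k : Fin K}
    (hk : k ∈ (exploreThenCommit K T tie).test b P N lam) (j : Fin K) : lam j ≤ lam k := by
  obtain ⟨S, hS, rfl⟩ :
      ∃ S : Finset (Fin K), (∀ i, i ∈ S ↔ ∀ j, lam j ≤ lam i) ∧ k = tie S := by
    refine ⟨_, ?_, Finset.mem_singleton.1 hk⟩
    simp
  obtain ⟨i, -, hi⟩ := Finset.exists_max_image Finset.univ lam Finset.univ_nonempty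
  exact (hS _).1 (htie S ⟨i, (hS i).2 fun j => hi j (Finset.mem_univ j)⟩) j

/-- The committed price beats the best one empirically, so its gap is at most the sum of the two
deviations. -/
lemma exploreThenCommit_gap_le (htie : ∀ S : Finset (Fin K), S.Nonempty → tie S ∈ S)
    (hq : K * etcPulls K T ≤ T) {d : ℕ → Fin K → ℝ} (hok : ¬ ETCFails T tie p m d) {k : Fin K}
    (hk : k ∈ ((exploreThenCommit K T tie).run T p d 1).plausible) :
    rewardGap p m k ≤ 2 * √(3 * Real.log (K * T) / etcPulls K T) := by
  obtain ⟨a, ha⟩ := exists_rewardGap_eq p m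
  set lam := empMean p d ((exploreThenCommit K T tie).run T p d 1).choice
    ((exploreThenCommit K T tie).run T p d 1).time with hlam
  have hdev : ∀ j, |lam j - p j * m j| ≤ √(3 * Real.log (K * T) / etcPulls K T) := fun j =>
    not_lt.1 fun hlt => hok ⟨j, exploreThenCommit_pullCount hq d j, hlt⟩
  have hkmax : lam a ≤ lam k := by
    rw [PhasedAlgorithm.run_succ_plausible] at hk
    exact le_of_mem_exploreThenCommit_test htie hk a
  rw [ha]
  linarith [(abs_le.1 (hdev a)).2, (abs_le.1 (hdev k)).1, (abs_le.1 (hdev a)).1,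
    (abs_le.1 (hdev k)).2]

lemma rpow_neg_two_thirds_mul (K T : ℕ) [NeZero K] :
    (K : ℝ) * ((K : ℝ) ^ (-(2 : ℝ) / 3) * (T : ℝ) ^ ((2 : ℝ) / 3))
      = (K : ℝ) ^ ((1 : ℝ) / 3) * (T : ℝ) ^ ((2 : ℝ) / 3) := by
  have hK : (0 : ℝ) < K := by exact_mod_cast NeZero.one_le (n := K)
  rw [← mul_assoc]
  congr 1
  nth_rw 1 [← Real.rpow_one (K : ℝ)]
  rw [← Real.rpow_add hK]
  norm_num

lemma one_le_rpow_neg_two_thirds_mul (hKT : K ≤ T) :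
    1 ≤ (K : ℝ) ^ (-(2 : ℝ) / 3) * (T : ℝ) ^ ((2 : ℝ) / 3) := by
  have hK : (0 : ℝ) < K := by exact_mod_cast NeZero.one_le (n := K)
  have h : (K : ℝ) ≤ T := by exact_mod_cast hKT
  calc (1 : ℝ) = (K : ℝ) ^ (-(2 : ℝ) / 3) * (K : ℝ) ^ ((2 : ℝ) / 3) := by
        rw [← Real.rpow_add hK]; norm_num
    _ ≤ _ := by gcongr

/-- Together with `rpow_neg_two_thirds_mul` this is the balance behind the exploration length: $Ky$
and $T/\sqrt y$ coincide. -/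
lemma mul_sqrt_inv_rpow (hT : 1 ≤ T) :
    (T : ℝ) * √(((K : ℝ) ^ (-(2 : ℝ) / 3) * (T : ℝ) ^ ((2 : ℝ) / 3))⁻¹)
      = (K : ℝ) ^ ((1 : ℝ) / 3) * (T : ℝ) ^ ((2 : ℝ) / 3) := by
  have hK : (0 : ℝ) < K := by exact_mod_cast NeZero.one_le (n := K)
  have hT0 : (0 : ℝ) < T := by exact_mod_cast hT
  have h : ((K : ℝ) ^ (-(2 : ℝ) / 3) * (T : ℝ) ^ ((2 : ℝ) / 3))⁻¹
      = ((K : ℝ) ^ ((1 : ℝ) / 3) * (T : ℝ) ^ (-(1 : ℝ) / 3)) ^ 2 := by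
    rw [mul_inv, ← Real.rpow_neg hK.le, ← Real.rpow_neg hT0.le, mul_pow, ← Real.rpow_natCast,
      ← Real.rpow_natCast, ← Real.rpow_mul hK.le, ← Real.rpow_mul hT0.le]
    norm_num
  rw [h, Real.sqrt_sq (by positivity), mul_left_comm]
  congr 1
  nth_rw 1 [← Real.rpow_one (T : ℝ)]
  rw [← Real.rpow_add hT0]
  norm_num

lemma exploreThenCommit_regret_le {Ω : Type*} [MeasurableSpace Ω] {μ : Measure Ω}
    [IsProbabilityMeasure μ] {D : ℕ → Fin K → Ω → ℝ} (hT : 1 ≤ T) (hKT : K ≤ T)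
    (htie : ∀ S : Finset (Fin K), S.Nonempty → tie S ∈ S)
    (hpm : Monotone p) (hp : ∀ k, p k ∈ Set.Icc (0 : ℝ) 1) (hD : IsIndepDemand μ T D m) (M : ℕ) :
    T * Finset.univ.sup' Finset.univ_nonempty (fun k : Fin K => p k * m k)
      - ∫ ω, revenue p T M ((exploreThenCommit K T tie).prices T p (fun t k => D t k ω))
        (fun t k => D t k ω) ∂μ
    ≤ 10 * (1 + Real.log (K * T)) * ((K : ℝ) ^ ((1 : ℝ) / 3) * (T : ℝ) ^ ((2 : ℝ) / 3)) := by
  have hA := exploreThenCommit_isProper (T := T) tie p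
  have hnum : (exploreThenCommit K T tie).numPhases = 2 := rfl
  have hgap : ∀ k, rewardGap p m k ≤ 1 := rewardGap_le_one hp (hD.mean_mem_Icc hT)
  have hK : (1 : ℝ) ≤ K := by exact_mod_cast NeZero.one_le (n := K)
  have hT1 : (1 : ℝ) ≤ T := by exact_mod_cast hT
  have hKT1 : (1 : ℝ) ≤ K * T := by nlinarith
  have hlog := Real.log_nonneg hKT1
  set Λ := 1 + Real.log (K * T) with hΛ
  have hΛ1 : 1 ≤ Λ := by linarith
  have hy1 := one_le_rpow_neg_two_thirds_mul hKT
  have hKy := rpow_neg_two_thirds_mul K T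
  have hTy := mul_sqrt_inv_rpow (K := K) hT
  set y := (K : ℝ) ^ (-(2 : ℝ) / 3) * (T : ℝ) ^ ((2 : ℝ) / 3) with hy
  set Y := (K : ℝ) ^ ((1 : ℝ) / 3) * (T : ℝ) ^ ((2 : ℝ) / 3) with hY
  have hY1 : 1 ≤ Y := by nlinarith
  have hΛY : Y ≤ Λ * Y := le_mul_of_one_le_left (by linarith) hΛ1
  have hyq : y ≤ etcPulls K T := Nat.le_ceil _
  have hq2 : (K : ℝ) * etcPulls K T ≤ 2 * Y := by
    have : (etcPulls K T : ℝ) ≤ y + 1 := (Nat.ceil_lt_add_one (by linarith)).le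
    nlinarith
  -- If exploration does not fit into the horizon, then $T\le Kq\le2Y$ and the trivial bound
  -- suffices.
  by_cases hq : K * etcPulls K T ≤ T
  swap
  · have h1 : (T : ℝ) ≤ K * etcPulls K T := by exact_mod_cast (not_le.1 hq).le
    have h2 := PhasedAlgorithm.regret_le_horizon (A := exploreThenCommit K T tie) hp
      (hD.mean_mem_Icc hT) hD M
    linarith
  have hq0 : 0 < etcPulls K T := by
    have : (0 : ℝ) < etcPulls K T := by linarith
    exact_mod_cast this
  set r := 2 * √(3 * Real.log (K * T) / etcPulls K T) with hr
  have hr0 : 0 ≤ r := by positivity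
  have hpath : ∀ d : ℕ → Fin K → ℝ,
      ∑ t ∈ Finset.range T, rewardGap p m ((exploreThenCommit K T tie).prices T p d t)
        ≤ (K * etcPulls K T + T * r)
          + T * {d | ETCFails T tie p m d}.indicator (fun _ => (1 : ℝ)) d := by
    intro d
    by_cases hok : ETCFails T tie p m d
    · rw [Set.indicator_of_mem (s := {d | ETCFails T tie p m d}) hok]
      have : ∑ t ∈ Finset.range T,
          rewardGap p m ((exploreThenCommit K T tie).prices T p d t) ≤ T := by
        refine (Finset.sum_le_sum fun t _ => hgap _).trans ?_
        simp
      have h1 : (0 : ℝ) ≤ K * etcPulls K T + T * r := by positivity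
      linarith
    · rw [Set.indicator_of_notMem (s := {d | ETCFails T tie p m d}) hok, mul_zero, add_zero]
      have ht1 := exploreThenCommit_time_one (tie := tie) (p := p) hq d
      rw [← Finset.sum_range_add_sum_Ico _ hq]
      refine add_le_add ?_ (sum_Ico_le_of_le hr0 fun t ht ht' => ?_)
      · refine (Finset.sum_le_sum fun t _ => hgap _).trans ?_
        simp
      · refine exploreThenCommit_gap_le htie hq hok
          (hA.prices_mem_plausible d (b := 1) (by omega) (by omega) ?_)
        rw [show ((exploreThenCommit K T tie).run T p d (1 + 1)).time = T from
          hA.run_numPhases_time d]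
        exact ht'
  -- Refunds arise only during exploration, hence do not grow with `M`.
  refine (hA.regret_le_of_forall_le (L := (K * etcPulls K T : ℕ)) hp hD M (fun d hd => ?_)
    (K * etcPulls K T + T * r) ({()} : Finset Unit) (c := fun _ => T) (fun _ _ => by positivity)
    (fun _ => {ω | ETCFails T tie p m fun t k => D t k ω})
    (fun ω => by rw [Finset.sum_singleton]; exact hpath _)).trans ?_
  · rw [← exploreThenCommit_time_one (tie := tie) (p := p) hq d]
    exact hA.sum_sub_revenue_le_time hpm hp hd M hnum.symm
  rw [Finset.sum_singleton]
  have hfail : T * μ.real {ω | ETCFails T tie p m fun t k => D t k ω} ≤ 2 := by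
    have h := hA.measureReal_exists_deviates_le hp hD (b := 1) (by omega) hq0
      (by positivity : 0 ≤ 3 * Real.log (K * T))
    have hexp : Real.exp (-(2 * (3 * Real.log (K * T)))) ≤ (K * T : ℝ)⁻¹ := by
      rw [← Real.exp_log (by positivity : (0 : ℝ) < K * T), ← Real.exp_neg, Real.log_exp]
      exact Real.exp_le_exp.2 (by linarith)
    calc _ ≤ T * (2 * K * (K * T : ℝ)⁻¹) := by
          gcongr
          exact h.trans (by gcongr)
      _ = 2 := by field_simp
  have hTr : T * r ≤ 4 * (Λ * Y) := by
    have h1 : r ≤ 4 * Λ * √(y⁻¹) := by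
      have h2 : √(3 * Real.log (K * T) / etcPulls K T) ≤ √((2 * Λ) ^ 2 * y⁻¹) := by
        apply Real.sqrt_le_sqrt
        rw [div_eq_mul_inv]
        gcongr
        nlinarith
      rw [Real.sqrt_mul (by positivity), Real.sqrt_sq (by positivity)] at h2
      linarith
    calc T * r ≤ T * (4 * Λ * √(y⁻¹)) := by gcongr
      _ = 4 * (Λ * (T * √(y⁻¹))) := by ring
      _ = 4 * (Λ * Y) := by rw [hTy]
  push_cast
  linarith

end

/-! ### Assembly of the three regimes. -/

/-- LEAP++ has expected regret `Õ(√(KT) + min {M, K^{1/3} T^{2/3}})`, with a universal constant and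
a universal power of the logarithm. -/
theorem mainTheorem6 :
    ∃ (C : ℝ) (n : ℕ), 0 < C ∧
      ∀ (K : ℕ) [NeZero K] (T M : ℕ), 1 ≤ T →
      ∀ (tie : Finset (Fin K) → Fin K), (∀ S : Finset (Fin K), S.Nonempty → tie S ∈ S) →
      ∀ (p : Fin K → ℝ), StrictMono p → (∀ k, p k ∈ Set.Icc (0 : ℝ) 1) →
      ∀ (Ω : Type*) [MeasurableSpace Ω] (μ : Measure Ω) [IsProbabilityMeasure μ]
        (D : ℕ → Fin K → Ω → ℝ), IsIIDDemand μ T D →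
      regret μ T M p D (leapPlusPlus K T M tie) ≤
        C * (1 + Real.log ((K : ℝ) * T)) ^ n *
          (√((K : ℝ) * T) + min (M : ℝ) ((K : ℝ) ^ ((1 : ℝ) / 3) * (T : ℝ) ^ ((2 : ℝ) / 3))) := by
  refine ⟨124, 2, by norm_num, ?_⟩
  intro K _ T M hT tie htie p hpm hp Ω _ μ _ D hD
  have hD' := hD.isIndepDemand_truncDemand hT
  have hA : (leapPlusPlus K T M tie).IsProper T p := by
    unfold leapPlusPlus
    split_ifs
    · exact improvedUCB_isProper p
    · exact batchedElimination_isProper hT p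
    · exact exploreThenCommit_isProper tie p
  rw [hD.regret_eq M hA]
  have hK : (1 : ℝ) ≤ K := by exact_mod_cast NeZero.one_le (n := K)
  have hT1 : (1 : ℝ) ≤ T := by exact_mod_cast hT
  have hKT1 : (1 : ℝ) ≤ K * T := by nlinarith
  have hlog := Real.log_nonneg hKT1
  have hlogT : Real.log T ≤ Real.log (K * T) := Real.log_le_log (by linarith) (by nlinarith)
  set Λ := 1 + Real.log ((K : ℝ) * T) with hΛ
  set S := √((K : ℝ) * T) with hS
  set Y := (K : ℝ) ^ ((1 : ℝ) / 3) * (T : ℝ) ^ ((2 : ℝ) / 3) with hY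
  have hΛ1 : 1 ≤ Λ := by linarith
  have hΛ2 : Λ ≤ Λ ^ 2 := by nlinarith
  have hS0 : 0 ≤ S := Real.sqrt_nonneg _
  have hY0 : 0 ≤ Y := by positivity
  have hM0 : (0 : ℝ) ≤ M := Nat.cast_nonneg M
  have hmin0 : 0 ≤ min (M : ℝ) Y := le_min hM0 hY0
  have hΛS : Λ * S ≤ Λ ^ 2 * S := by gcongr
  have hΛS0 : 0 ≤ Λ ^ 2 * S := by positivity
  have hΛm0 : 0 ≤ Λ ^ 2 * min (M : ℝ) Y := by positivity
  -- The bounds for improved UCB and explore-then-commit need $K\le T$; otherwise $T\le\sqrt{KT}$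
  -- already bounds the regret.
  rcases lt_or_ge T K with hTK | hKT
  · have h1 := PhasedAlgorithm.regret_le_horizon (A := leapPlusPlus K T M tie) hp
      (hD'.mean_mem_Icc hT) hD' M
    have h2 : (T : ℝ) ≤ S := by
      apply Real.le_sqrt_of_sq_le
      have : (T : ℝ) ≤ K := by exact_mod_cast hTK.le
      nlinarith
    have h3 : S ≤ Λ * S := le_mul_of_one_le_left hS0 hΛ1
    linarith
  by_cases hM1 : (M : ℝ) ≤ S
  · have hleap : leapPlusPlus K T M tie = improvedUCB K T := if_pos hM1
    rw [hleap]
    refine (improvedUCB_regret_le hT hKT hpm.monotone hp hD' M).trans ?_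
    have h0 : 1 + Real.log T ≤ Λ := by linarith
    have h1 : (1 + Real.log T) * S ≤ Λ * S := by gcongr
    -- In this regime $M\le\sqrt{KT}$ absorbs the refunds, and the minimum is simply dropped.
    have h2 : (1 + Real.log T) * M ≤ Λ * S := by
      have := Real.log_nonneg hT1
      gcongr
    linarith
  by_cases hM2 : (M : ℝ) < Y
  · have hleap : leapPlusPlus K T M tie = batchedElimination K T := by
      unfold leapPlusPlus
      rw [if_neg hM1, if_pos hM2]
    rw [hleap, min_eq_left hM2.le]
    refine (batchedElimination_regret_le hT hpm.monotone hp hD' M).trans ?_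
    have h1 : Λ * M ≤ Λ ^ 2 * M := by gcongr
    have h2 : 0 ≤ Λ ^ 2 * M := by positivity
    linarith
  · have hleap : leapPlusPlus K T M tie = exploreThenCommit K T tie := by
      unfold leapPlusPlus
      rw [if_neg hM1, if_neg hM2]
    rw [hleap, min_eq_right (not_lt.1 hM2)]
    refine (exploreThenCommit_regret_le hT hKT htie hpm.monotone hp hD' M).trans ?_
    have h1 : Λ * Y ≤ Λ ^ 2 * Y := by gcongr
    have h2 : 0 ≤ Λ ^ 2 * Y := by positivity
    linarith
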